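/- Let $W$ be a standard Wiener process (with continuous paths) relative to a filtration on a probability space, let $I\subseteq\mathbb R$ be an open interval, and let $a_x,b_x:I\to\mathbb R$ be such that $a_x$ is continuous, $b_x$ is continuously differentiable and $b_x$ has no zero in $I$. Consider the Itô dynamic $$dx=a_x(x)\,dt+b_x(x)\,dW \qquad (*)$$ in $I$. A solution is an adapted process with continuous paths in $I$ on a random time interval $[0,\tau)$, where $\tau\in[0,\infty]$ is a stopping time, that satisfies $(*)$ there. (1) Let $u$ be twice continuously differentiable on $I$, let $a_u,b_u\in\mathbb R$, and let $x$ be a solution of $(*)$ on $[0,\tau)$. Then $u(x(t))$ is a Brownian motion with constant drift $a_u$ and volatility $b_u$ driven by $W$, i.e. $du=a_u\,dt+b_u\,dW$ on $[0,\tau)$, if and only if almost surely the two equations $$a_u=a_x u'+\tfrac12 b_x^2u'',\qquad b_u=b_xu'$$ hold at $x(t)$ for all $t<\tau$. Now say that $u$ maps the dynamic to a Brownian motion with drift $a_u$ and volatility $b_u$ if $(*)$ has, for every $y\in I$, a solution with $x(0)=y$ and $\tau>0$ almost surely, and if for every solution $x$ of $(*)$ one has $du(x(t))=a_u\,dt+b_u\,dW$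 on $[0,\tau)$. Let $a_u,b_u$ be real constants with $b_u\neq0$. (2) A twice continuously differentiable $u$ on $I$ maps the dynamic to a Brownian motion with drift $a_u$ and volatility $b_u$ if and only if, for all $x\in I$, $$u'(x)=\frac{b_u}{b_x(x)}\qquad\text{and}\qquad a_x(x)=\frac{a_u}{b_u}\,b_x(x)+\frac12\,b_x(x)\,b_x'(x).$$ (3) There is a strictly monotone (increasing or decreasing), twice continuously differentiable $u$ on $I$ that maps the dynamic to a Brownian motion with drift $a_u$ and volatility $b_u$ if and only if the consistency condition $a_x=\frac{a_u}{b_u}b_x+\frac12b_xb_x'$ holds on $I$. (4) If the consistency condition holds and $x_0\in I$, then the twice continuously differentiable functions $u$ on $I$ that map the dynamic to a Brownian motion with drift $a_u$ and volatility $b_u$ are exactly the functions $$u(x)=\int_{x_0}^x\frac{b_u}{b_x(\tilde x)}\,d\tilde x+C,\qquad C\in\mathbb R.$$ (5) There are constants $a_u$, $b_u\ne0$ and a strictly increasing, twice continuously differentiable $u$ on $I$ that maps the dynamic to a Brownian motion with drift $a_u$ and volatility $b_u$ if and only if there is a constant $k$ with $a_x=k\,b_x+\frac12b_xb_x'$ on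 $I$. -/

import Mathlib

open MeasureTheory ProbabilityTheory Filter Topology
open scoped NNReal ENNReal

/-- `W` is a standard Wiener process relative to the filtration `ℱ` (with continuous paths):
a Brownian motion adapted to `ℱ` whose increments after time `s` are independent of `ℱ s`. -/
structure IsWienerProcess {Ω : Type*} {mΩ : MeasurableSpace Ω} (P : Measure Ω)
    (ℱ : Filtration ℝ≥0 mΩ) (W : ℝ≥0 → Ω → ℝ) : Prop where
  isBrownian : IsBrownianReal W P
  continuous : ∀ ω, Continuous fun t => W t ω
  adapted : StronglyAdapted ℱ W
  indep : ∀ s t : ℝ≥0, s ≤ t →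
    Indep (MeasurableSpace.comap (fun ω => W t ω - W s ω) inferInstance) (ℱ s) P

/-- `0 = s n 0 ≤ s n 1 ≤ ⋯ ≤ s n (N n) = t` is, for each `n`, a partition of `[0, t]`, and the mesh
of these partitions tends to zero as `n → ∞`. -/
structure IsPartitionSeq (t : ℝ≥0) (N : ℕ → ℕ) (s : ℕ → ℕ → ℝ≥0) : Prop where
  mono : ∀ n, Monotone (s n)
  start : ∀ n, s n 0 = 0
  finish : ∀ n, s n (N n) = t
  mesh : ∀ δ : ℝ≥0, 0 < δ → ∀ᶠ n in atTop, ∀ i < N n, s n (i + 1) ≤ s n i + δ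

/-- `Y` is, at time `t` and on the event `{t < τ}`, the Itô integral `∫₀ᵗ H dW` of the process `H`
(adapted and with continuous paths on `[0, τ)`): the limit in probability on that event of the
left-endpoint Riemann sums, along every sequence of partitions of `[0, t]` with vanishing mesh. -/
def IsItoIntegralAt {Ω : Type*} {mΩ : MeasurableSpace Ω} (P : Measure Ω) (W H : ℝ≥0 → Ω → ℝ)
    (τ : Ω → WithTop ℝ≥0) (t : ℝ≥0) (Y : Ω → ℝ) : Prop :=
  ∀ (N : ℕ → ℕ) (s : ℕ → ℕ → ℝ≥0), IsPartitionSeq t N s →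
    TendstoInMeasure (P.restrict {ω | (t : WithTop ℝ≥0) < τ ω})
      (fun n ω => ∑ i ∈ Finset.range (N n),
        H (s n i) ω * (W (s n (i + 1)) ω - W (s n i) ω)) atTop Y

/-- `x` is a solution with values in `I`, up to the stopping time `τ`, of the Itô equation
`dx = a(x) dt + b(x) dW` (`a`, `b` continuous on `I`): on `[0, τ)` it is adapted, continuous,
`I`-valued, and `x(t) - x(0) = ∫₀ᵗ a(x(r)) dr + ∫₀ᵗ b(x(r)) dW(r)`.  The values of `x` from time `τ`
on play no role; `τ = ⊤` is a solution for all times. -/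
structure IsItoSolution {Ω : Type*} {mΩ : MeasurableSpace Ω} (P : Measure Ω)
    (ℱ : Filtration ℝ≥0 mΩ) (W : ℝ≥0 → Ω → ℝ) (I : Set ℝ) (a b : ℝ → ℝ)
    (x : ℝ≥0 → Ω → ℝ) (τ : Ω → WithTop ℝ≥0) : Prop where
  isStoppingTime : IsStoppingTime ℱ τ
  adapted : ∀ t : ℝ≥0,
    StronglyMeasurable[ℱ t] ({ω | (t : WithTop ℝ≥0) < τ ω}.indicator (x t))
  continuousOn : ∀ ω, ContinuousOn (fun t => x t ω) {t : ℝ≥0 | (t : WithTop ℝ≥0) < τ ω}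
  mem : ∀ (ω : Ω) (t : ℝ≥0), (t : WithTop ℝ≥0) < τ ω → x t ω ∈ I
  sde : ∀ t : ℝ≥0, IsItoIntegralAt P W (fun r ω => b (x r ω)) τ t
    (fun ω => x t ω - x 0 ω - ∫ r in (0 : ℝ)..(t : ℝ), a (x r.toNNReal ω))

/-- Up to the stopping time `τ`, the process `U` is a Brownian motion with constant drift `aᵤ` and
constant volatility `bᵤ` driven by `W`, that is, `dU = aᵤ dt + bᵤ dW`. -/
def IsBrownianWithDrift {Ω : Type*} {mΩ : MeasurableSpace Ω} (P : Measure Ω)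
    (ℱ : Filtration ℝ≥0 mΩ) (W : ℝ≥0 → Ω → ℝ) (aᵤ bᵤ : ℝ)
    (U : ℝ≥0 → Ω → ℝ) (τ : Ω → WithTop ℝ≥0) : Prop :=
  IsItoSolution P ℱ W Set.univ (fun _ => aᵤ) (fun _ => bᵤ) U τ

/-- The utility `u` turns the dynamic `dx = a(x) dt + b(x) dW` on `I` into a Brownian motion with
drift `aᵤ` and volatility `bᵤ`: the dynamic can be started at every wealth in `I`, and along every
solution `x` of it the utility `u(x(t))` is such a Brownian motion for the lifetime of `x`. -/
def MapsToBrownian {Ω : Type*} {mΩ : MeasurableSpace Ω} (P : Measure Ω)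
    (ℱ : Filtration ℝ≥0 mΩ) (W : ℝ≥0 → Ω → ℝ) (I : Set ℝ) (a b u : ℝ → ℝ) (aᵤ bᵤ : ℝ) : Prop :=
  (∀ y ∈ I, ∃ (x : ℝ≥0 → Ω → ℝ) (τ : Ω → WithTop ℝ≥0),
    IsItoSolution P ℱ W I a b x τ ∧ ∀ᵐ ω ∂P, 0 < τ ω ∧ x 0 ω = y) ∧
  ∀ (x : ℝ≥0 → Ω → ℝ) (τ : Ω → WithTop ℝ≥0), IsItoSolution P ℱ W I a b x τ →
    IsBrownianWithDrift P ℱ W aᵤ bᵤ (fun t ω => u (x t ω)) τ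

/-! ### Convergence in measure: subsequences, diagonals, truncation. -/

section Convergence

variable {Ω : Type*} {mΩ : MeasurableSpace Ω}

/-! The core is an Itô formula up to a stopping time, with the stochastic integral known only as a
limit in probability of left-endpoint sums. On one interval of a partition, the `eulerError` is the
stochastic integral minus its integrand frozen at the left endpoint. It is a limit of sums over
refinements whose coefficients β(x) - β(x at the left endpoint) are small along each path.
Truncating these coefficients and using the L² orthogonality of the increments
(`integral_sq_sum_mul_le`), one finds that weighted sums of the errors, and sums of their squares,
vanish in probability. The same estimate gives ∑ g(x)((ΔW)² - Δt) → 0. Along a common subsequence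
all these limits hold almost surely, and `HasItoDifferential.ito` reduces to a second-order Taylor
expansion of each path.

Drift and volatility are determined along the paths (`HasItoDifferential.unique`): if β and β' are
both volatilities of one process, then ∑ (β - β')²(ΔW)² tends to 0 and also to ∫ (β - β')² dt. The
stochastic integrals then agree, hence so do the drift integrals. Itô's formula and uniqueness
together give the criterion along a single solution.

For the dynamic on all of I, a solution started at y, read at time 0, turns the almost sure
equations into equations at y. The volatility equation gives u' = bᵤ/b; differentiating it and
inserting u'' in the drift equation leaves exactly the consistency condition. Conversely, that
condition makes u⁻¹ of a Brownian motion with drift, started at u(y) and run until it leaves u(I), a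
solution started at y, so no existence theory for stochastic equations is needed. The remaining
claims are calculus: antiderivatives of bᵤ/b, and the constant sign of b on an interval. -/

theorem MeasureTheory.TendstoInMeasure.mono_measure {μ ν : Measure Ω} (h : μ ≤ ν)
    {f : ℕ → Ω → ℝ} {g : Ω → ℝ} (hf : TendstoInMeasure ν f atTop g) :
    TendstoInMeasure μ f atTop g := fun ε hε =>
  tendsto_of_tendsto_of_tendsto_of_le_of_le tendsto_const_nhds (hf ε hε)
    (fun _ => zero_le) (fun _ => h _)

theorem tendstoInMeasure_pi {κ : Type*} [Fintype κ] {μ : Measure Ω}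
    {X : κ → ℕ → Ω → ℝ} {Y : κ → Ω → ℝ} (h : ∀ k, TendstoInMeasure μ (X k) atTop (Y k)) :
    TendstoInMeasure μ (fun n ω k => X k n ω) atTop (fun ω k => Y k ω) := by
  rw [tendstoInMeasure_iff_dist]
  intro ε hε
  have h1 : Tendsto (fun n => ∑ k, μ {ω | ε ≤ dist (X k n ω) (Y k ω)}) atTop (𝓝 0) := by
    rw [show (0 : ℝ≥0∞) = ∑ k : κ, 0 by simp]
    exact tendsto_finsetSum _ fun k _ => tendstoInMeasure_iff_dist.1 (h k) ε hε
  refine tendsto_of_tendsto_of_tendsto_of_le_of_le tendsto_const_nhds h1 (fun _ => zero_le) ?_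
  intro n
  refine (measure_mono ?_).trans (measure_biUnion_finset_le Finset.univ _)
  intro ω hω
  simp only [Set.mem_ofPred_eq, Finset.mem_univ, Set.iUnion_true, Set.mem_iUnion] at hω ⊢
  by_contra! hcon
  exact absurd hω (not_le.2 ((dist_pi_lt_iff hε).2 hcon))

/-- Finitely many sequences that converge in measure do so almost everywhere along a common
subsequence. -/
theorem exists_common_subseq_tendsto_ae {κ : Type*} [Fintype κ] {μ : Measure Ω}
    {X : κ → ℕ → Ω → ℝ} {Y : κ → Ω → ℝ} (h : ∀ k, TendstoInMeasure μ (X k) atTop (Y k)) :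
    ∃ ns : ℕ → ℕ, StrictMono ns ∧
      ∀ᵐ ω ∂μ, ∀ k, Tendsto (fun i => X k (ns i) ω) atTop (𝓝 (Y k ω)) := by
  obtain ⟨ns, hns, hae⟩ := (tendstoInMeasure_pi h).exists_seq_tendsto_ae
  exact ⟨ns, hns, hae.mono fun ω hω k => tendsto_pi_nhds.1 hω k⟩

/-- If a sequence of random variables converges pathwise along every subsequence along which
finitely many others do, and these converge in measure, then so does the sequence. -/
theorem tendstoInMeasure_of_subseq {κ : Type*} [Fintype κ] {μ : Measure Ω} [IsFiniteMeasure μ]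
    {X : κ → ℕ → Ω → ℝ} {Y : κ → Ω → ℝ} (h : ∀ k, TendstoInMeasure μ (X k) atTop (Y k))
    {F : ℕ → Ω → ℝ} {G : Ω → ℝ} (hF : ∀ n, AEStronglyMeasurable (F n) μ)
    (hFG : ∀ᵐ ω ∂μ, ∀ ns : ℕ → ℕ, StrictMono ns →
      (∀ k, Tendsto (fun i => X k (ns i) ω) atTop (𝓝 (Y k ω))) →
      Tendsto (fun i => F (ns i) ω) atTop (𝓝 (G ω))) :
    TendstoInMeasure μ F atTop G := by
  rw [exists_seq_tendstoInMeasure_atTop_iff hF]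
  intro ns hns
  obtain ⟨ns', hns', hae⟩ :=
    exists_common_subseq_tendsto_ae (fun k => (h k).comp hns.tendsto_atTop)
  refine ⟨ns', hns', ?_⟩
  filter_upwards [hFG, hae] with ω h1 h2
  exact h1 (ns ∘ ns') (hns.comp hns') h2

/-- For each n choose k(n) so late that `F n (k n)` is within 1/(n+1) of `G n` off a set of measure
at most 1/(n+1); the diagonal then carries `G` to zero. It transfers estimates that are uniform over
all refinements to the stochastic integrals themselves. -/
theorem tendstoInMeasure_zero_of_diagonal {μ : Measure Ω}
    {F : ℕ → ℕ → Ω → ℝ} {G : ℕ → Ω → ℝ} (hFG : ∀ n, TendstoInMeasure μ (F n) atTop (G n))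
    (h0 : ∀ k : ℕ → ℕ, TendstoInMeasure μ (fun n => F n (k n)) atTop (fun _ => 0)) :
    TendstoInMeasure μ G atTop (fun _ => 0) := by
  have hk : ∀ n : ℕ, ∃ k, μ {ω | (1 / ((n : ℝ) + 1)) ≤ ‖F n k ω - G n ω‖}
      ≤ ((n : ℝ≥0∞) + 1)⁻¹ := by
    intro n
    have h1 := tendstoInMeasure_iff_norm.1 (hFG n) (1 / ((n : ℝ) + 1)) (by positivity)
    have h2 : (0 : ℝ≥0∞) < ((n : ℝ≥0∞) + 1)⁻¹ := by simp
    exact ((h1.eventually (gt_mem_nhds h2)).mono fun _ h => h.le).exists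
  choose k hk using hk
  rw [tendstoInMeasure_iff_norm]
  intro ε hε
  have h1 := tendstoInMeasure_iff_norm.1 (h0 k) (ε / 2) (half_pos hε)
  have h2 : Tendsto (fun n : ℕ => ((n : ℝ≥0∞) + 1)⁻¹) atTop (𝓝 0) := by
    have := ENNReal.tendsto_inv_nat_nhds_zero.comp (tendsto_add_atTop_nat 1)
    refine this.congr fun n => by simp
  have h3 := h1.add h2
  rw [add_zero] at h3
  refine tendsto_of_tendsto_of_tendsto_of_le_of_le' tendsto_const_nhds h3
    (Eventually.of_forall fun _ => zero_le) ?_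
  have h4 : ∀ᶠ n : ℕ in atTop, 1 / ((n : ℝ) + 1) < ε / 2 :=
    tendsto_one_div_add_atTop_nhds_zero_nat.eventually (gt_mem_nhds (half_pos hε))
  filter_upwards [h4] with n hn
  refine le_trans (le_trans (measure_mono ?_) (measure_union_le
    {ω | ε / 2 ≤ ‖F n (k n) ω - 0‖} {ω | (1 / ((n : ℝ) + 1)) ≤ ‖F n (k n) ω - G n ω‖}))
    (add_le_add le_rfl (hk n))
  intro ω hω
  simp only [Set.mem_ofPred_eq, Set.mem_union, sub_zero] at hω ⊢
  by_contra! hcon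
  have h5 : ‖G n ω‖ ≤ ‖F n (k n) ω‖ + ‖F n (k n) ω - G n ω‖ := by
    have := norm_sub_le (F n (k n) ω) (F n (k n) ω - G n ω)
    simpa using this
  linarith [hcon.1, hcon.2]

/-- Convergence to zero in measure on `T` by truncation at a random level that is negligible. -/
theorem tendstoInMeasure_zero_of_truncation {P : Measure Ω} [IsProbabilityMeasure P] {T : Set Ω}
    (hT : MeasurableSet T) {N : ℕ → ℕ} {ξ : ℕ → ℕ → Ω → ℝ} (hξ : ∀ n j, Measurable (ξ n j))
    {c : ℕ → ℝ} (hc : ∀ n, 0 < c n) {S : ℕ → Ω → ℝ} {S' : ℕ → ℝ → Ω → ℝ} {C : ℝ} (hC : 0 ≤ C)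
    (hS : ∀ n K, ∀ ω ∈ T, (∀ j < N n, |ξ n j ω| ≤ K) → S n ω = S' n K ω)
    (hnn : ∀ n K ω, 0 ≤ S' n K ω)
    (hint : ∀ n K, 0 ≤ K → Integrable (S' n K) P ∧ ∫ ω, S' n K ω ∂P ≤ K ^ 2 * (C * c n ^ 2))
    (hmax : ∀ ω ∈ T, ∀ δ > 0, ∀ᶠ n in atTop, ∀ j < N n, c n * |ξ n j ω| ≤ δ) :
    TendstoInMeasure (P.restrict T) S atTop (fun _ => 0) := by
  rw [tendstoInMeasure_iff_measureReal_norm]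
  intro ε hε
  rw [Metric.tendsto_atTop']
  intro η hη
  -- Truncation at level δ / c n bounds the integral by C δ²; the choice of δ makes Markov's
  -- inequality at ε yield less than η/2.
  obtain ⟨δ, hδ, hδ2⟩ : ∃ δ : ℝ, 0 < δ ∧ C * δ ^ 2 < ε * (η / 2) := by
    refine ⟨√(ε * (η / 2) / (C + 1)), by positivity, ?_⟩
    rw [Real.sq_sqrt (by positivity), ← mul_div_assoc, div_lt_iff₀ (by positivity)]
    have : 0 < ε * (η / 2) := by positivity
    nlinarith
  set E : ℕ → Set Ω := fun n => {ω | ∃ j < N n, δ < c n * |ξ n j ω|} with hE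
  have hEm : ∀ n, MeasurableSet (E n) := by
    intro n
    have : E n = ⋃ j ∈ Finset.range (N n), {ω | δ < c n * |ξ n j ω|} := by
      ext ω; simp [hE]
    rw [this]
    refine Finset.measurableSet_biUnion _ fun j _ => measurableSet_lt measurable_const ?_
    exact ((hξ n j).abs).const_mul _
  -- Truncation matters only on `E n`. Each path in T eventually leaves these sets, so on the finite
  -- measure their mass tends to zero by dominated convergence.
  have hE0 : Tendsto (fun n => (P.restrict T).real (E n)) atTop (𝓝 0) := by
    have h1 := tendsto_measure_of_ae_tendsto_indicator (μ := P.restrict T) (A := ∅) (As := E)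
      atTop MeasurableSet.empty hEm (B := Set.univ) MeasurableSet.univ (by finiteness)
      (Eventually.of_forall fun _ => Set.subset_univ _) (by
        refine (ae_restrict_iff' hT).2 (ae_of_all _ fun ω hω => ?_)
        filter_upwards [hmax ω hω δ hδ] with n hn
        simp only [Set.mem_empty_iff_false, iff_false, hE, Set.mem_ofPred_eq, not_exists, not_and,
          not_lt]
        exact hn)
    rw [measure_empty] at h1
    exact (ENNReal.tendsto_toReal_zero_iff (fun _ => by finiteness)).2 h1
  obtain ⟨n₀, hn₀⟩ := Metric.tendsto_atTop'.1 hE0 (η / 2) (by positivity)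
  refine ⟨n₀, fun n hn => ?_⟩
  have h1 := hn₀ n hn
  rw [Real.dist_eq, sub_zero, abs_of_nonneg measureReal_nonneg] at h1 ⊢
  obtain ⟨hi, hb⟩ := hint n (δ / c n) (by have := hc n; positivity)
  have hM := mul_meas_ge_le_integral_of_nonneg (ae_of_all _ (hnn n (δ / c n))) hi ε
  have hb' : (δ / c n) ^ 2 * (C * c n ^ 2) = C * δ ^ 2 := by
    have := (hc n).ne'
    field_simp
  have h2 : P.real {ω | ε ≤ S' n (δ / c n) ω} < η / 2 := by
    by_contra! hcon
    have : ε * (η / 2) ≤ ε * P.real {ω | ε ≤ S' n (δ / c n) ω} := by gcongr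
    linarith
  have hsub : {ω | ε ≤ ‖S n ω - 0‖} ∩ T ⊆ (E n ∩ T) ∪ {ω | ε ≤ S' n (δ / c n) ω} := by
    rintro ω ⟨hω, hωT⟩
    by_cases hωE : ω ∈ E n
    · exact Or.inl ⟨hωE, hωT⟩
    · right
      simp only [hE, Set.mem_ofPred_eq, not_exists, not_and, not_lt] at hωE
      have := hS n (δ / c n) ω hωT fun j hj => by
        rw [le_div_iff₀ (hc n), mul_comm]; exact hωE j hj
      simp only [Set.mem_ofPred_eq, sub_zero, Real.norm_eq_abs] at hω ⊢
      rwa [this, abs_of_nonneg (hnn _ _ _)] at hω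
  have e1 : (P.restrict T).real {ω | ε ≤ ‖S n ω - 0‖} = P.real ({ω | ε ≤ ‖S n ω - 0‖} ∩ T) := by
    simp [measureReal_def, Measure.restrict_apply' hT]
  have e2 : (P.restrict T).real (E n) = P.real (E n ∩ T) := by
    simp [measureReal_def, Measure.restrict_apply' hT]
  rw [e1]
  rw [e2] at h1
  have := measureReal_mono (μ := P) hsub
  have := measureReal_union_le (μ := P) (E n ∩ T) {ω | ε ≤ S' n (δ / c n) ω}
  linarith

end Convergence

/-! ### Orthogonality of innovations in L². -/

section SquareBound

variable {Ω : Type*} {mΩ : MeasurableSpace Ω} {P : Measure Ω}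

/-- The `L²` bound for a sum of centred square-integrable innovations with bounded predictable
coefficients. -/
theorem integral_sq_sum_mul_le [IsProbabilityMeasure P] {m : ℕ → MeasurableSpace Ω}
    (hm : Monotone m) (hle : ∀ i, m i ≤ mΩ) {ξ D : ℕ → Ω → ℝ} {K : ℝ}
    (hξ : ∀ i, Measurable[m i] (ξ i)) (hK : ∀ i ω, |ξ i ω| ≤ K)
    (hD : ∀ i, Measurable[m (i + 1)] (D i)) (hD2 : ∀ i, MemLp (D i) 2 P)
    (hind : ∀ i, Indep (MeasurableSpace.comap (D i) inferInstance) (m i) P)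
    (h0 : ∀ i, ∫ ω, D i ω ∂P = 0) (N : ℕ) :
    MemLp (fun ω => ∑ i ∈ Finset.range N, ξ i ω * D i ω) 2 P ∧
      ∫ ω, (∑ i ∈ Finset.range N, ξ i ω * D i ω) ^ 2 ∂P
        ≤ K ^ 2 * ∑ i ∈ Finset.range N, ∫ ω, D i ω ^ 2 ∂P := by
  have hb : ∀ i, MemLp (fun ω => ξ i ω * D i ω) 2 P := fun i =>
    (hD2 i).of_le_mul (c := K)
      (((hξ i).mono (hle i) le_rfl).aestronglyMeasurable.mul (hD2 i).1)
      (ae_of_all _ fun ω => by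
        rw [norm_mul]
        exact mul_le_mul_of_nonneg_right (hK i ω) (norm_nonneg _))
  have hmeas : ∀ N, Measurable[m N] (fun ω => ∑ i ∈ Finset.range N, ξ i ω * D i ω) := by
    intro N
    refine Finset.measurable_sum _ fun i hi => ?_
    have hi' := Finset.mem_range.1 hi
    exact ((hξ i).mono (hm hi'.le) le_rfl).mul ((hD i).mono (hm hi') le_rfl)
  induction N with
  | zero => simp
  | succ N ih =>
    obtain ⟨ih1, ih2⟩ := ih
    set S : Ω → ℝ := fun ω => ∑ i ∈ Finset.range N, ξ i ω * D i ω with hS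
    have hSm : Measurable[m N] S := hmeas N
    have hstep : ∀ ω, ∑ i ∈ Finset.range (N + 1), ξ i ω * D i ω = S ω + ξ N ω * D N ω :=
      fun ω => Finset.sum_range_succ _ _
    simp only [hstep]
    refine ⟨ih1.add (hb N), ?_⟩
    have hSξ : Measurable[m N] (fun ω => S ω * ξ N ω) := hSm.mul (hξ N)
    have hI : IndepFun (fun ω => S ω * ξ N ω) (D N) P := by
      rw [IndepFun_iff_Indep]
      exact indep_of_indep_of_le_left (hind N).symm hSξ.comap_le
    -- The past sum and the coefficient are known at stage N, while the innovation is centred and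
    -- independent of that stage.
    have hcross : ∫ ω, S ω * ξ N ω * D N ω ∂P = 0 := by
      rw [hI.integral_fun_mul_eq_mul_integral (hSξ.mono (hle N) le_rfl).aestronglyMeasurable
        (hD2 N).1, h0 N, mul_zero]
    have hSint : Integrable (fun ω => S ω ^ 2) P := ih1.integrable_sq
    have hξDint : Integrable (fun ω => (ξ N ω * D N ω) ^ 2) P := (hb N).integrable_sq
    have hcint : Integrable (fun ω => S ω * ξ N ω * D N ω) P := by
      have := ih1.integrable_mul (hb N)
      refine this.congr (ae_of_all _ fun ω => ?_)
      simp [mul_assoc]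
    have hexp : ∀ ω, (S ω + ξ N ω * D N ω) ^ 2
        = S ω ^ 2 + 2 * (S ω * ξ N ω * D N ω) + (ξ N ω * D N ω) ^ 2 := fun ω => by ring
    simp only [hexp]
    have hadd : Integrable (fun ω => S ω ^ 2 + 2 * (S ω * ξ N ω * D N ω)) P :=
      hSint.add (hcint.const_mul 2)
    rw [integral_add hadd hξDint, integral_add hSint (hcint.const_mul 2), integral_const_mul,
      hcross, Finset.sum_range_succ, mul_add]
    have hlast : ∫ ω, (ξ N ω * D N ω) ^ 2 ∂P ≤ K ^ 2 * ∫ ω, D N ω ^ 2 ∂P := by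
      rw [← integral_const_mul]
      refine integral_mono hξDint ((hD2 N).integrable_sq.const_mul _) fun ω => ?_
      simp only [mul_pow]
      exact mul_le_mul_of_nonneg_right
        (sq_le_sq' (abs_le.1 (hK N ω)).1 (abs_le.1 (hK N ω)).2) (sq_nonneg _)
    linarith

end SquareBound

/-! ### Moments and independence of Wiener increments. -/

section Increments

variable {Ω : Type*} {mΩ : MeasurableSpace Ω} {P : Measure Ω} {ℱ : Filtration ℝ≥0 mΩ}
  {W : ℝ≥0 → Ω → ℝ}

namespace IsWienerProcess

theorem isProbabilityMeasure (hW : IsWienerProcess P ℱ W) : IsProbabilityMeasure P :=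
  hW.isBrownian.isGaussianProcess.isProbabilityMeasure

theorem measurable (hW : IsWienerProcess P ℱ W) (t : ℝ≥0) : Measurable[ℱ t] (W t) :=
  (hW.adapted t).measurable

theorem measurable_increment (hW : IsWienerProcess P ℱ W) {s t : ℝ≥0} (hst : s ≤ t) :
    Measurable[ℱ t] (fun ω => W t ω - W s ω) :=
  (hW.measurable t).sub ((hW.measurable s).mono (ℱ.mono hst) le_rfl)

theorem hasLaw_increment (hW : IsWienerProcess P ℱ W) {s t : ℝ≥0} (hst : s ≤ t) :
    HasLaw (fun ω => W t ω - W s ω) (gaussianReal 0 (t - s)) P := by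
  have h := hW.isBrownian.hasLaw_sub t s
  have e : nndist t.1 s.1 = t - s := by
    apply NNReal.eq
    rw [coe_nndist, Real.dist_eq, NNReal.coe_sub hst, abs_of_nonneg]
    · rfl
    · exact sub_nonneg.2 (NNReal.coe_le_coe.2 hst)
  rwa [e] at h

theorem memLp_increment (hW : IsWienerProcess P ℱ W) {s t : ℝ≥0} (hst : s ≤ t) (p : ℝ≥0) :
    MemLp (fun ω => W t ω - W s ω) p P := by
  have h := hW.hasLaw_increment hst
  have h1 := memLp_id_gaussianReal (μ := 0) (v := t - s) p
  rw [← h.map_eq] at h1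
  exact (memLp_map_measure_iff h1.1 h.aemeasurable).1 h1

theorem integral_increment (hW : IsWienerProcess P ℱ W) {s t : ℝ≥0} (hst : s ≤ t) :
    ∫ ω, (W t ω - W s ω) ∂P = 0 := by
  rw [(hW.hasLaw_increment hst).integral_eq, integral_id_gaussianReal]

theorem integral_sq_increment (hW : IsWienerProcess P ℱ W) {s t : ℝ≥0} (hst : s ≤ t) :
    ∫ ω, (W t ω - W s ω) ^ 2 ∂P = (t : ℝ) - s := by
  have := hW.isProbabilityMeasure
  have h := (hW.hasLaw_increment hst).variance_eq
  rw [variance_id_gaussianReal, variance_eq_integral (hW.hasLaw_increment hst).aemeasurable,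
    hW.integral_increment hst, NNReal.coe_sub hst] at h
  simpa using h

/-- Scaling: the increment has the law of √(t - s) times a standard Gaussian. The Gaussian constant
is left unevaluated, since later only its nonnegativity matters. -/
theorem integral_sq_sub_sq_increment (hW : IsWienerProcess P ℱ W) {s t : ℝ≥0} (hst : s ≤ t) :
    ∫ ω, ((W t ω - W s ω) ^ 2 - ((t : ℝ) - s)) ^ 2 ∂P
      = ((t : ℝ) - s) ^ 2 * ∫ z, (z ^ 2 - 1) ^ 2 ∂(gaussianReal 0 1) := by
  have h := hW.hasLaw_increment hst
  have e : (t : ℝ) - s = ((t - s : ℝ≥0) : ℝ) := (NNReal.coe_sub hst).symm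
  rw [e]
  generalize t - s = v at h
  have h1 := h.integral_comp (f := fun z : ℝ => (z ^ 2 - (v : ℝ)) ^ 2)
    (by fun_prop)
  have h2 : gaussianReal 0 v = (gaussianReal 0 1).map (fun z => √(v : ℝ) * z) := by
    rw [gaussianReal_map_const_mul]
    congr 1
    · simp
    · ext; simp
  rw [h2, integral_map (by fun_prop) (by fun_prop)] at h1
  simp only [Function.comp_def] at h1
  rw [h1, ← integral_const_mul]
  congr 1
  ext z
  rw [mul_pow, Real.sq_sqrt v.coe_nonneg]
  ring

theorem memLp_sq_increment (hW : IsWienerProcess P ℱ W) {s t : ℝ≥0} (hst : s ≤ t) :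
    MemLp (fun ω => (W t ω - W s ω) ^ 2 - ((t : ℝ) - s)) 2 P := by
  have := hW.isProbabilityMeasure
  refine MemLp.sub ?_ (memLp_const _)
  have h := hW.memLp_increment hst 4
  have h1 := h.norm_rpow_div 2
  have e : ((4 : ℝ≥0) : ℝ≥0∞) / 2 = 2 := by
    rw [show ((4 : ℝ≥0) : ℝ≥0∞) = 2 * 2 by norm_num]
    exact ENNReal.mul_div_cancel_right (by simp) (by simp)
  rw [e] at h1
  refine h1.congr_norm ?_ (ae_of_all _ fun ω => ?_)
  · exact ((hW.measurable_increment hst).mono (ℱ.le t) le_rfl).pow_const 2 |>.aestronglyMeasurable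
  · simp

theorem integral_sq_increment_sub (hW : IsWienerProcess P ℱ W) {s t : ℝ≥0} (hst : s ≤ t) :
    ∫ ω, ((W t ω - W s ω) ^ 2 - ((t : ℝ) - s)) ∂P = 0 := by
  have := hW.isProbabilityMeasure
  rw [integral_sub (hW.memLp_increment hst 2).integrable_sq (integrable_const _),
    hW.integral_sq_increment hst]
  simp

theorem indep_sq_increment (hW : IsWienerProcess P ℱ W) {s t : ℝ≥0} (hst : s ≤ t) :
    Indep (MeasurableSpace.comap
      (fun ω => (W t ω - W s ω) ^ 2 - ((t : ℝ) - s)) inferInstance) (ℱ s) P := by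
  refine indep_of_indep_of_le_left (hW.indep s t hst) ?_
  have : (fun ω => (W t ω - W s ω) ^ 2 - ((t : ℝ) - s))
      = (fun z : ℝ => z ^ 2 - ((t : ℝ) - s)) ∘ (fun ω => W t ω - W s ω) := rfl
  rw [this, ← MeasurableSpace.comap_comp]
  exact MeasurableSpace.comap_mono (Measurable.comap_le (by fun_prop))

end IsWienerProcess

end Increments

/-! ### Equal subdivision of partitions. -/

section Partitions

theorem Finset.sum_range_mul_eq_sum_sum {M : Type*} [AddCommMonoid M] (h : ℕ → M) (N m : ℕ) :
    ∑ j ∈ Finset.range (N * m), h j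
      = ∑ i ∈ Finset.range N, ∑ k ∈ Finset.range m, h (i * m + k) := by
  induction N with
  | zero => simp
  | succ N ih => rw [Nat.succ_mul, Finset.sum_range_add, ih, Finset.sum_range_succ]

/-- The subdivision of every interval of the partition `s` into `m + 1` equal parts. -/
noncomputable def refinePartition (s : ℕ → ℝ≥0) (m j : ℕ) : ℝ≥0 :=
  s (j / (m + 1)) + ((j % (m + 1) : ℕ) : ℝ≥0) / ((m : ℝ≥0) + 1)
    * (s (j / (m + 1) + 1) - s (j / (m + 1)))

theorem refinePartition_block {s : ℕ → ℝ≥0} (m i : ℕ) {k : ℕ} (hk : k < m + 1) :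
    refinePartition s m (i * (m + 1) + k)
      = s i + (k : ℝ≥0) / ((m : ℝ≥0) + 1) * (s (i + 1) - s i) := by
  have h1 : (i * (m + 1) + k) / (m + 1) = i := by
    rw [mul_comm, Nat.mul_add_div (Nat.succ_pos m), Nat.div_eq_of_lt hk, add_zero]
  have h2 : (i * (m + 1) + k) % (m + 1) = k := by
    rw [mul_comm, Nat.mul_add_mod, Nat.mod_eq_of_lt hk]
  rw [refinePartition, h1, h2]

theorem refinePartition_mul (s : ℕ → ℝ≥0) (m i : ℕ) :
    refinePartition s m (i * (m + 1)) = s i := by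
  have := refinePartition_block (s := s) m i (Nat.succ_pos m)
  simpa using this

theorem refinePartition_block_succ {s : ℕ → ℝ≥0} (hs : Monotone s) (m i : ℕ) {k : ℕ}
    (hk : k < m + 1) :
    refinePartition s m (i * (m + 1) + k + 1)
      = refinePartition s m (i * (m + 1) + k) + (s (i + 1) - s i) / ((m : ℝ≥0) + 1) := by
  rw [refinePartition_block m i hk]
  have hm : ((m : ℝ≥0) + 1) ≠ 0 := by positivity
  rcases Nat.lt_or_ge (k + 1) (m + 1) with h | h
  · rw [add_assoc (i * (m + 1)), refinePartition_block m i h]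
    push_cast
    field_simp
    ring
  -- At the last point of a block the successor is the first point of the next block; monotonicity
  -- is needed because subtraction in `ℝ≥0` is truncated.
  · have hkm : k = m := by omega
    subst hkm
    have e : i * (k + 1) + k + 1 = (i + 1) * (k + 1) := by ring
    rw [e, refinePartition_mul]
    have e2 : (k : ℝ≥0) / ((k : ℝ≥0) + 1) * (s (i + 1) - s i)
        + (s (i + 1) - s i) / ((k : ℝ≥0) + 1) = s (i + 1) - s i := by
      field_simp
    rw [add_assoc, e2, add_tsub_cancel_of_le (hs (Nat.le_succ i))]

theorem exists_block (m j : ℕ) : ∃ i k, k < m + 1 ∧ j = i * (m + 1) + k :=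
  ⟨j / (m + 1), j % (m + 1), Nat.mod_lt _ (Nat.succ_pos m), by
    rw [mul_comm]; exact (Nat.div_add_mod j (m + 1)).symm⟩

theorem refinePartition_monotone {s : ℕ → ℝ≥0} (hs : Monotone s) (m : ℕ) :
    Monotone (refinePartition s m) := by
  refine monotone_nat_of_le_succ fun j => ?_
  obtain ⟨i, k, hk, rfl⟩ := exists_block m j
  rw [refinePartition_block_succ hs m i hk]
  exact le_self_add

/-- The partition `s` is fixed and the fineness m is the sequence index, so the definition of the
Itô integral can be tested at each time `s i` along refinements of the same partition. -/
theorem isPartitionSeq_refinePartition {s : ℕ → ℝ≥0} (hs : Monotone s) (h0 : s 0 = 0) (i : ℕ) :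
    IsPartitionSeq (s i) (fun m => i * (m + 1)) (fun m => refinePartition s m) where
  mono m := refinePartition_monotone hs m
  start m := by simpa [h0] using refinePartition_mul s m 0
  finish m := refinePartition_mul s m i
  mesh δ hδ := by
    have h1 : Tendsto (fun m : ℕ => (s i : ℝ) / ((m : ℝ) + 1)) atTop (𝓝 0) := by
      have := tendsto_one_div_add_atTop_nhds_zero_nat (𝕜 := ℝ).const_mul (s i : ℝ)
      simpa [div_eq_mul_inv] using this
    filter_upwards [h1.eventually (gt_mem_nhds (show (0 : ℝ) < δ from hδ))] with m hm j hj
    obtain ⟨l, k, hk, rfl⟩ := exists_block m j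
    have hl : l < i := by
      by_contra! hcon
      have := Nat.mul_le_mul_right (m + 1) hcon
      omega
    rw [refinePartition_block_succ hs m l hk]
    gcongr
    have h2 : s (l + 1) - s l ≤ s i := tsub_le_self.trans (hs hl)
    have h3 : s i / ((m : ℝ≥0) + 1) ≤ δ := by
      rw [← NNReal.coe_le_coe]
      push_cast
      exact hm.le
    exact (by gcongr : (s (l + 1) - s l) / ((m : ℝ≥0) + 1) ≤ s i / ((m : ℝ≥0) + 1)).trans h3

theorem IsPartitionSeq.le {t : ℝ≥0} {N : ℕ → ℕ} {s : ℕ → ℕ → ℝ≥0} (h : IsPartitionSeq t N s)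
    {n i : ℕ} (hi : i ≤ N n) : s n i ≤ t := by
  rw [← h.finish n]; exact h.mono n hi

theorem IsPartitionSeq.comp {t : ℝ≥0} {N : ℕ → ℕ} {s : ℕ → ℕ → ℝ≥0} (h : IsPartitionSeq t N s)
    {ns : ℕ → ℕ} (hns : StrictMono ns) :
    IsPartitionSeq t (fun i => N (ns i)) (fun i => s (ns i)) where
  mono _ := h.mono _
  start _ := h.start _
  finish _ := h.finish _
  mesh δ hδ := hns.tendsto_atTop.eventually (h.mesh δ hδ)

end Partitions

/-! ### Adapted paths with a lifetime, and one-step Euler errors. -/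

section Paths

theorem isCompact_Iic_nnreal (t : ℝ≥0) : IsCompact (Set.Iic t) := by
  rw [← Set.Icc_bot]; exact isCompact_Icc

theorem ContinuousOn.exists_bound_Iic {t : ℝ≥0} {φ : ℝ≥0 → ℝ} (h : ContinuousOn φ (Set.Iic t)) :
    ∃ C : ℝ, 0 < C ∧ ∀ r ≤ t, |φ r| ≤ C := by
  obtain ⟨C, hC⟩ := (isCompact_Iic_nnreal t).exists_bound_of_continuousOn h
  exact ⟨max C 1, by positivity, fun r hr => (hC r hr).trans (le_max_left _ _)⟩

theorem ContinuousOn.exists_modulus_Iic {t : ℝ≥0} {φ : ℝ≥0 → ℝ} (h : ContinuousOn φ (Set.Iic t))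
    {δ : ℝ} (hδ : 0 < δ) :
    ∃ η : ℝ≥0, 0 < η ∧ ∀ r s, r ≤ s → s ≤ t → s ≤ r + η → |φ s - φ r| ≤ δ := by
  have hu := (isCompact_Iic_nnreal t).uniformContinuousOn_of_continuous h
  obtain ⟨η, hη, hη'⟩ := Metric.uniformContinuousOn_iff_le.1 hu δ hδ
  refine ⟨⟨η, hη.le⟩, hη, fun r s hrs hst hs => ?_⟩
  have := hη' s hst r (hrs.trans hst) (by
    rw [NNReal.dist_eq, abs_of_nonneg (sub_nonneg.2 (NNReal.coe_le_coe.2 hrs))]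
    have : (s : ℝ) ≤ r + η := NNReal.coe_le_coe.2 hs
    linarith)
  exact this

theorem ContinuousOn.comp_toNNReal {t : ℝ≥0} {φ : ℝ≥0 → ℝ} (h : ContinuousOn φ (Set.Iic t)) :
    ContinuousOn (fun r : ℝ => φ r.toNNReal) (Set.Iic (t : ℝ)) :=
  h.comp continuous_real_toNNReal.continuousOn fun r hr => by
    simpa using Real.toNNReal_le_toNNReal (Set.mem_Iic.1 hr)

theorem ContinuousOn.intervalIntegrable_toNNReal {t : ℝ≥0} {φ : ℝ≥0 → ℝ}
    (h : ContinuousOn φ (Set.Iic t)) {p q : ℝ} (hp : p ≤ t) (hq : q ≤ t) :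
    IntervalIntegrable (fun r : ℝ => φ r.toNNReal) volume p q :=
  (h.comp_toNNReal.mono fun _ hr => (Set.mem_uIcc.1 hr).elim (fun h => h.2.trans hq)
    fun h => h.2.trans hp).intervalIntegrable

variable {Ω : Type*} {mΩ : MeasurableSpace Ω}

/-- The event that the lifetime `τ` exceeds `t`. -/
abbrev alive (τ : Ω → WithTop ℝ≥0) (t : ℝ≥0) : Set Ω := {ω | (t : WithTop ℝ≥0) < τ ω}

/-- `x` is an adapted process with continuous paths in `I` up to the stopping time `τ`. -/
structure IsAdaptedPath (ℱ : Filtration ℝ≥0 mΩ) (I : Set ℝ)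
    (x : ℝ≥0 → Ω → ℝ) (τ : Ω → WithTop ℝ≥0) : Prop where
  isStoppingTime : IsStoppingTime ℱ τ
  adapted : ∀ t : ℝ≥0, StronglyMeasurable[ℱ t] ((alive τ t).indicator (x t))
  continuousOn : ∀ ω, ContinuousOn (fun t => x t ω) {t : ℝ≥0 | (t : WithTop ℝ≥0) < τ ω}
  mem : ∀ (ω : Ω) (t : ℝ≥0), (t : WithTop ℝ≥0) < τ ω → x t ω ∈ I

theorem alive_anti (τ : Ω → WithTop ℝ≥0) {s t : ℝ≥0} (h : s ≤ t) : alive τ t ⊆ alive τ s :=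
  fun _ hω => lt_of_le_of_lt (WithTop.coe_le_coe.2 h) hω

variable {ℱ : Filtration ℝ≥0 mΩ} {I : Set ℝ} {x : ℝ≥0 → Ω → ℝ} {τ : Ω → WithTop ℝ≥0}

theorem MeasureTheory.IsStoppingTime.measurableSet_alive (h : IsStoppingTime ℱ τ) (t : ℝ≥0) :
    MeasurableSet[ℱ t] (alive τ t) := by
  have e : alive τ t = {ω | τ ω ≤ t}ᶜ := by
    ext ω
    exact (not_le (a := τ ω) (b := (t : WithTop ℝ≥0))).symm
  rw [e]
  exact (h.measurableSet_le t).compl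

namespace IsAdaptedPath

theorem measurableSet_alive (h : IsAdaptedPath ℱ I x τ) (t : ℝ≥0) :
    MeasurableSet (alive τ t) := ℱ.le t _ (h.isStoppingTime.measurableSet_alive t)

/-- Beyond the lifetime x is arbitrary and may leave I, where g need not be measurable. Extending g
by zero off the open set I gives a Borel function that agrees with g along the path while it is
alive. -/
theorem measurable_indicator (h : IsAdaptedPath ℱ I x τ) (hI : IsOpen I) {g : ℝ → ℝ}
    (hg : ContinuousOn g I) {s r : ℝ≥0} (hsr : s ≤ r) :
    Measurable[ℱ r] ((alive τ r).indicator (fun ω => g (x s ω))) := by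
  classical
  have hg' : Measurable (I.piecewise g fun _ => 0) :=
    hg.measurable_piecewise continuousOn_const hI.measurableSet
  have h1 : Measurable[ℱ s] ((alive τ s).indicator (x s)) := (h.adapted s).measurable
  have h2 : Measurable[ℱ r]
      (fun ω => (I.piecewise g fun _ => 0) ((alive τ s).indicator (x s) ω)) :=
    (hg'.comp h1).mono (ℱ.mono hsr) le_rfl
  have e : (alive τ r).indicator (fun ω => g (x s ω)) = (alive τ r).indicator
      (fun ω => (I.piecewise g fun _ => 0) ((alive τ s).indicator (x s) ω)) := by
    refine Set.indicator_congr fun ω hω => ?_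
    have hs := alive_anti τ hsr hω
    rw [Set.indicator_of_mem hs, Set.piecewise_eq_of_mem _ _ _ (h.mem ω s hs)]
  rw [e]
  exact h2.indicator (h.isStoppingTime.measurableSet_alive r)

theorem aestronglyMeasurable (h : IsAdaptedPath ℱ I x τ) (hI : IsOpen I) {g : ℝ → ℝ}
    (hg : ContinuousOn g I) {s t : ℝ≥0} (hst : s ≤ t) (P : Measure Ω) :
    AEStronglyMeasurable (fun ω => g (x s ω)) (P.restrict (alive τ t)) := by
  have h1 := ((h.measurable_indicator hI hg hst).mono (ℱ.le t) le_rfl).aestronglyMeasurable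
    (μ := P.restrict (alive τ t))
  exact h1.congr (indicator_ae_eq_restrict (h.measurableSet_alive t))

theorem continuousOn_comp (h : IsAdaptedPath ℱ I x τ) {g : ℝ → ℝ} (hg : ContinuousOn g I)
    {t : ℝ≥0} {ω : Ω} (hω : ω ∈ alive τ t) :
    ContinuousOn (fun r => g (x r ω)) (Set.Iic t) :=
  hg.comp ((h.continuousOn ω).mono fun _ hr => alive_anti τ hr hω)
    fun r hr => h.mem ω r (alive_anti τ hr hω)

end IsAdaptedPath

/-- The process `f (x)` has the stochastic differential `α(x) dt + β(x) dW` on `[0, τ)`. -/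
def HasItoDifferential (P : Measure Ω) (W x : ℝ≥0 → Ω → ℝ) (τ : Ω → WithTop ℝ≥0)
    (f α β : ℝ → ℝ) : Prop :=
  ∀ t : ℝ≥0, IsItoIntegralAt P W (fun r ω => β (x r ω)) τ t
    (fun ω => f (x t ω) - f (x 0 ω) - ∫ r in (0 : ℝ)..(t : ℝ), α (x r.toNNReal ω))

/-- The error of the one-step Euler approximation of `f (x)` on the `i`-th interval. -/
noncomputable def eulerError (W x : ℝ≥0 → Ω → ℝ) (f α β : ℝ → ℝ) (s : ℕ → ℝ≥0) (i : ℕ)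
    (ω : Ω) : ℝ :=
  f (x (s (i + 1)) ω) - f (x (s i) ω) - (∫ r in (s i : ℝ)..(s (i + 1) : ℝ), α (x r.toNNReal ω))
    - β (x (s i) ω) * (W (s (i + 1)) ω - W (s i) ω)

/-- The approximation of `eulerError` by Riemann sums over a refined partition. -/
noncomputable def refinedError (W x : ℝ≥0 → Ω → ℝ) (β : ℝ → ℝ) (s : ℕ → ℝ≥0) (m i : ℕ) (ω : Ω) :
    ℝ :=
  ∑ k ∈ Finset.range (m + 1),
    (β (x (refinePartition s m (i * (m + 1) + k)) ω) - β (x (s i) ω)) *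
      (W (refinePartition s m (i * (m + 1) + k + 1)) ω
        - W (refinePartition s m (i * (m + 1) + k)) ω)

/-- The integral is defined only from time 0, so the sum over one interval has to be exhibited as a
difference of two sums from 0; the frozen term telescopes. -/
theorem refinedError_eq (W x : ℝ≥0 → Ω → ℝ) (β : ℝ → ℝ) (s : ℕ → ℝ≥0) (m i : ℕ) (ω : Ω) :
    refinedError W x β s m i ω =
      (∑ j ∈ Finset.range ((i + 1) * (m + 1)), β (x (refinePartition s m j) ω) *
        (W (refinePartition s m (j + 1)) ω - W (refinePartition s m j) ω))
      - (∑ j ∈ Finset.range (i * (m + 1)), β (x (refinePartition s m j) ω) *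
        (W (refinePartition s m (j + 1)) ω - W (refinePartition s m j) ω))
      - β (x (s i) ω) * (W (s (i + 1)) ω - W (s i) ω) := by
  have h1 := Finset.sum_range_sub (fun k => W (refinePartition s m (i * (m + 1) + k)) ω) (m + 1)
  have e : i * (m + 1) + (m + 1) = (i + 1) * (m + 1) := by ring
  simp only [e, add_zero, refinePartition_mul] at h1
  rw [← h1, Finset.mul_sum, ← e, Finset.sum_range_add, add_sub_cancel_left,
    ← Finset.sum_sub_distrib]
  refine Finset.sum_congr rfl fun k _ => ?_
  rw [← add_assoc]
  ring

variable {P : Measure Ω} {W : ℝ≥0 → Ω → ℝ}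

theorem refinedError_aestronglyMeasurable (hW : IsWienerProcess P ℱ W)
    (h : IsAdaptedPath ℱ I x τ) (hI : IsOpen I) {β : ℝ → ℝ} (hβ : ContinuousOn β I)
    {s : ℕ → ℝ≥0} (hs : Monotone s) {t : ℝ≥0} {i : ℕ} (hi : s (i + 1) ≤ t) (m : ℕ) :
    AEStronglyMeasurable (refinedError W x β s m i) (P.restrict (alive τ t)) := by
  refine Finset.aestronglyMeasurable_fun_sum _ fun k hk => ?_
  have hWm : ∀ r, AEStronglyMeasurable (W r) (P.restrict (alive τ t)) := fun r =>
    ((hW.measurable r).mono (ℱ.le r) le_rfl).aestronglyMeasurable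
  have hr : refinePartition s m (i * (m + 1) + k) ≤ t := by
    refine le_trans ?_ hi
    rw [← refinePartition_mul s m (i + 1)]
    refine refinePartition_monotone hs m ?_
    have := Finset.mem_range.1 hk
    rw [Nat.succ_mul]; omega
  exact ((h.aestronglyMeasurable hI hβ hr P).sub
    (h.aestronglyMeasurable hI hβ ((hs (Nat.le_succ i)).trans hi) P)).mul ((hWm _).sub (hWm _))

theorem tendstoInMeasure_refinedError (hW : IsWienerProcess P ℱ W)
    (h : IsAdaptedPath ℱ I x τ) (hI : IsOpen I) {f α β : ℝ → ℝ} (hα : ContinuousOn α I)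
    (hβ : ContinuousOn β I) (hf : HasItoDifferential P W x τ f α β)
    {s : ℕ → ℝ≥0} (hs : Monotone s) (h0 : s 0 = 0) {t : ℝ≥0} {i : ℕ} (hi : s (i + 1) ≤ t) :
    TendstoInMeasure (P.restrict (alive τ t)) (fun m => refinedError W x β s m i) atTop
      (eulerError W x f α β s i) := by
  have := hW.isProbabilityMeasure
  have hi' : s i ≤ t := (hs (Nat.le_succ i)).trans hi
  have key : ∀ l : ℕ, s l ≤ t → TendstoInMeasure (P.restrict (alive τ t))
      (fun m ω => ∑ j ∈ Finset.range (l * (m + 1)), β (x (refinePartition s m j) ω) *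
        (W (refinePartition s m (j + 1)) ω - W (refinePartition s m j) ω)) atTop
      (fun ω => f (x (s l) ω) - f (x 0 ω)
        - ∫ r in (0 : ℝ)..(s l : ℝ), α (x r.toNNReal ω)) := fun l hl =>
    (hf (s l) _ _ (isPartitionSeq_refinePartition hs h0 l)).mono_measure
      (Measure.restrict_mono (alive_anti τ hl) le_rfl)
  -- The two values of the index stand for the endpoints: `true` for `s (i + 1)`, `false` for `s i`.
  refine tendstoInMeasure_of_subseq (κ := Bool)
    (X := fun b m ω => ∑ j ∈ Finset.range ((cond b (i + 1) i) * (m + 1)),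
      β (x (refinePartition s m j) ω) *
        (W (refinePartition s m (j + 1)) ω - W (refinePartition s m j) ω))
    (Y := fun b ω => f (x (s (cond b (i + 1) i)) ω) - f (x 0 ω)
        - ∫ r in (0 : ℝ)..(s (cond b (i + 1) i) : ℝ), α (x r.toNNReal ω))
    (fun b => key _ (by cases b <;> assumption))
    (refinedError_aestronglyMeasurable hW h hI hβ hs hi) ?_
  refine (ae_restrict_iff' (h.measurableSet_alive t)).2 (ae_of_all _ fun ω hω ns hns hX => ?_)
  have h1 := ((hX true).sub (hX false)).sub_const (β (x (s i) ω) * (W (s (i + 1)) ω - W (s i) ω))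
  simp only [cond_true, cond_false] at h1
  have hc := h.continuousOn_comp hα hω
  have hint : (∫ r in (0 : ℝ)..(s (i + 1) : ℝ), α (x r.toNNReal ω))
      - (∫ r in (0 : ℝ)..(s i : ℝ), α (x r.toNNReal ω))
      = ∫ r in (s i : ℝ)..(s (i + 1) : ℝ), α (x r.toNNReal ω) :=
    intervalIntegral.integral_interval_sub_left
      (hc.intervalIntegrable_toNNReal t.coe_nonneg (NNReal.coe_le_coe.2 hi))
      (hc.intervalIntegrable_toNNReal t.coe_nonneg (NNReal.coe_le_coe.2 hi'))
  have e : eulerError W x f α β s i ω = f (x (s (i + 1)) ω) - f (x 0 ω)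
        - (∫ r in (0 : ℝ)..(s (i + 1) : ℝ), α (x r.toNNReal ω))
      - (f (x (s i) ω) - f (x 0 ω) - ∫ r in (0 : ℝ)..(s i : ℝ), α (x r.toNNReal ω))
      - β (x (s i) ω) * (W (s (i + 1)) ω - W (s i) ω) := by
    rw [eulerError, ← hint]; ring
  rw [e]
  refine h1.congr fun m => ?_
  rw [refinedError_eq]

end Paths

/-! ### Vanishing of sums with small predictable coefficients. -/

section Arrays

/-- The value `z` if it is at most `K` in modulus, and zero otherwise. -/
noncomputable def truncateAt (K z : ℝ) : ℝ := if |z| ≤ K then z else 0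

theorem measurable_truncateAt (K : ℝ) : Measurable (truncateAt K) :=
  Measurable.ite (measurableSet_le measurable_id.abs measurable_const) measurable_id
    measurable_const

theorem abs_truncateAt_le {K : ℝ} (hK : 0 ≤ K) (z : ℝ) : |truncateAt K z| ≤ K := by
  unfold truncateAt
  split_ifs with h
  · exact h
  · simpa using hK

theorem truncateAt_eq {K z : ℝ} (h : |z| ≤ K) : truncateAt K z = z := if_pos h

variable {Ω : Type*} {mΩ : MeasurableSpace Ω} {P : Measure Ω}

/-- After truncation of the coefficients at K, orthogonality within each block bounds the expected
sum of squared block sums by K² times the total variance. The scale `c n` balances the two: the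
variance is of order `c n ^ 2`, while the coefficients times `c n` vanish pathwise. -/
theorem tendstoInMeasure_sum_sq_sum [IsProbabilityMeasure P] {T : Set Ω} (hT : MeasurableSet T)
    {m : ℕ → ℕ → MeasurableSpace Ω} (hm : ∀ n, Monotone (m n)) (hle : ∀ n j, m n j ≤ mΩ)
    {ξ D : ℕ → ℕ → Ω → ℝ} (hξ : ∀ n j, Measurable[m n j] (ξ n j))
    (hD : ∀ n j, Measurable[m n (j + 1)] (D n j)) (hD2 : ∀ n j, MemLp (D n j) 2 P)
    (hind : ∀ n j, Indep (MeasurableSpace.comap (D n j) inferInstance) (m n j) P)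
    (h0 : ∀ n j, ∫ ω, D n j ω ∂P = 0) {N M : ℕ → ℕ} {c : ℕ → ℝ} (hc : ∀ n, 0 < c n) {C : ℝ}
    (hC : 0 ≤ C)
    (hV : ∀ n, ∑ j ∈ Finset.range (N n * M n), ∫ ω, D n j ω ^ 2 ∂P ≤ C * c n ^ 2)
    (hmax : ∀ ω ∈ T, ∀ δ > 0, ∀ᶠ n in atTop, ∀ j < N n * M n, c n * |ξ n j ω| ≤ δ) :
    TendstoInMeasure (P.restrict T) (fun n ω => ∑ i ∈ Finset.range (N n),
      (∑ k ∈ Finset.range (M n), ξ n (i * M n + k) ω * D n (i * M n + k) ω) ^ 2) atTop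
      (fun _ => 0) := by
  refine tendstoInMeasure_zero_of_truncation hT (N := fun n => N n * M n) (ξ := ξ)
    (fun n j => (hξ n j).mono (hle n j) le_rfl) hc
    (S' := fun n K ω => ∑ i ∈ Finset.range (N n),
      (∑ k ∈ Finset.range (M n),
        truncateAt K (ξ n (i * M n + k) ω) * D n (i * M n + k) ω) ^ 2) hC ?_
    (fun n K ω => Finset.sum_nonneg fun i _ => sq_nonneg _) ?_ hmax
  · intro n K ω _ hK
    refine Finset.sum_congr rfl fun i hi => ?_
    congr 1
    refine Finset.sum_congr rfl fun k hk => ?_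
    rw [truncateAt_eq (hK _ _)]
    have hi' := Finset.mem_range.1 hi
    have hk' := Finset.mem_range.1 hk
    calc i * M n + k < i * M n + M n := by omega
      _ = (i + 1) * M n := by ring
      _ ≤ N n * M n := Nat.mul_le_mul_right _ hi'
  · intro n K hK
    have hb := fun i => integral_sq_sum_mul_le (P := P) (m := fun k => m n (i * M n + k))
      (fun k l hkl => hm n (Nat.add_le_add_left hkl _)) (fun k => hle n _)
      (ξ := fun k ω => truncateAt K (ξ n (i * M n + k) ω)) (D := fun k => D n (i * M n + k))
      (K := K) (fun k => (measurable_truncateAt K).comp (hξ n _))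
      (fun k ω => abs_truncateAt_le hK _) (fun k => hD n _) (fun k => hD2 n _)
      (fun k => hind n _) (fun k => h0 n _) (M n)
    refine ⟨integrable_finsetSum _ fun i _ => (hb i).1.integrable_sq, ?_⟩
    rw [integral_finsetSum _ fun i _ => (hb i).1.integrable_sq]
    calc _ ≤ ∑ i ∈ Finset.range (N n),
          K ^ 2 * ∑ k ∈ Finset.range (M n), ∫ ω, D n (i * M n + k) ω ^ 2 ∂P :=
          Finset.sum_le_sum fun i _ => (hb i).2
      _ = K ^ 2 * ∑ j ∈ Finset.range (N n * M n), ∫ ω, D n j ω ^ 2 ∂P := by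
          rw [← Finset.mul_sum, Finset.sum_range_mul_eq_sum_sum]
      _ ≤ K ^ 2 * (C * c n ^ 2) := by gcongr; exact hV n

theorem tendstoInMeasure_sum_mul [IsProbabilityMeasure P] {T : Set Ω} (hT : MeasurableSet T)
    {m : ℕ → ℕ → MeasurableSpace Ω} (hm : ∀ n, Monotone (m n)) (hle : ∀ n j, m n j ≤ mΩ)
    {ξ D : ℕ → ℕ → Ω → ℝ} (hξ : ∀ n j, Measurable[m n j] (ξ n j))
    (hD : ∀ n j, Measurable[m n (j + 1)] (D n j)) (hD2 : ∀ n j, MemLp (D n j) 2 P)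
    (hind : ∀ n j, Indep (MeasurableSpace.comap (D n j) inferInstance) (m n j) P)
    (h0 : ∀ n j, ∫ ω, D n j ω ∂P = 0) {N : ℕ → ℕ} {c : ℕ → ℝ} (hc : ∀ n, 0 < c n) {C : ℝ}
    (hC : 0 ≤ C) (hV : ∀ n, ∑ j ∈ Finset.range (N n), ∫ ω, D n j ω ^ 2 ∂P ≤ C * c n ^ 2)
    (hmax : ∀ ω ∈ T, ∀ δ > 0, ∀ᶠ n in atTop, ∀ j < N n, c n * |ξ n j ω| ≤ δ) :
    TendstoInMeasure (P.restrict T) (fun n ω => ∑ j ∈ Finset.range (N n), ξ n j ω * D n j ω) atTop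
      (fun _ => 0) := by
  -- A single block containing the whole array: the square of the full sum tends to zero.
  have h := tendstoInMeasure_sum_sq_sum hT hm hle hξ hD hD2 hind h0 (N := fun _ => 1) (M := N) hc
    hC (by simpa using hV) (by simpa using hmax)
  rw [tendstoInMeasure_iff_norm] at h ⊢
  intro ε hε
  refine tendsto_of_tendsto_of_tendsto_of_le_of_le tendsto_const_nhds (h (ε ^ 2) (by positivity))
    (fun _ => zero_le) fun n => measure_mono fun ω hω => ?_
  simp only [Set.mem_ofPred_eq, sub_zero, Finset.range_one, Finset.sum_singleton, zero_mul,
    zero_add, norm_pow] at hω ⊢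
  gcongr

end Arrays

/-! ### Euler errors and compensated squares vanish in probability. -/

section Errors

theorem le_refinePartition (s : ℕ → ℝ≥0) (m j : ℕ) : s (j / (m + 1)) ≤ refinePartition s m j :=
  le_self_add

theorem refinePartition_le {s : ℕ → ℝ≥0} (hs : Monotone s) (m j : ℕ) :
    refinePartition s m j ≤ s (j / (m + 1) + 1) := by
  rw [← refinePartition_mul s m (j / (m + 1) + 1)]
  refine refinePartition_monotone hs m ?_
  have := Nat.div_add_mod j (m + 1)
  have : j % (m + 1) < m + 1 := Nat.mod_lt j (Nat.succ_pos m)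
  rw [Nat.succ_mul, mul_comm]
  omega

variable {Ω : Type*} {mΩ : MeasurableSpace Ω} {P : Measure Ω} {ℱ : Filtration ℝ≥0 mΩ}
  {W x : ℝ≥0 → Ω → ℝ} {I : Set ℝ} {τ : Ω → WithTop ℝ≥0} {t : ℝ≥0} {N : ℕ → ℕ} {s : ℕ → ℕ → ℝ≥0}

/-- The coefficients in the Riemann sums for `g (x) * eulerError`, extended by zero. -/
noncomputable def errorCoeff (x : ℝ≥0 → Ω → ℝ) (τ : Ω → WithTop ℝ≥0) (g β : ℝ → ℝ) (s : ℕ → ℝ≥0)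
    (m j : ℕ) (ω : Ω) : ℝ :=
  (alive τ (refinePartition s m j)).indicator (fun ω => g (x (s (j / (m + 1))) ω)) ω *
    ((alive τ (refinePartition s m j)).indicator (fun ω => β (x (refinePartition s m j) ω)) ω -
      (alive τ (refinePartition s m j)).indicator (fun ω => β (x (s (j / (m + 1))) ω)) ω)

theorem measurable_errorCoeff (h : IsAdaptedPath ℱ I x τ) (hI : IsOpen I) {g β : ℝ → ℝ}
    (hg : ContinuousOn g I) (hβ : ContinuousOn β I) (s : ℕ → ℝ≥0) (m j : ℕ) :
    Measurable[ℱ (refinePartition s m j)] (errorCoeff x τ g β s m j) :=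
  (h.measurable_indicator hI hg (le_refinePartition s m j)).mul
    ((h.measurable_indicator hI hβ le_rfl).sub
      (h.measurable_indicator hI hβ (le_refinePartition s m j)))

theorem errorCoeff_eq {g β : ℝ → ℝ} {s : ℕ → ℝ≥0} {m j : ℕ} {ω : Ω}
    (hω : ω ∈ alive τ t) (hj : refinePartition s m j ≤ t) :
    errorCoeff x τ g β s m j ω = g (x (s (j / (m + 1))) ω) *
      (β (x (refinePartition s m j) ω) - β (x (s (j / (m + 1))) ω)) := by
  have := alive_anti τ hj hω
  simp only [errorCoeff, Set.indicator_of_mem this]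

theorem IsPartitionSeq.refinePartition_le (hp : IsPartitionSeq t N s) {n m j : ℕ}
    (hj : j ≤ N n * (m + 1)) : refinePartition (s n) m j ≤ t := by
  rw [← hp.finish n, ← refinePartition_mul (s n) m (N n)]
  exact refinePartition_monotone (hp.mono n) m hj

/-- Along a path alive at t, g is bounded and β uniformly continuous, and a refined point lies
within the coarse mesh of its left endpoint. Hence the bound does not depend on the refinement `k`,
as the diagonal argument requires. -/
theorem errorCoeff_eventually_le (h : IsAdaptedPath ℱ I x τ) {g β : ℝ → ℝ}
    (hg : ContinuousOn g I) (hβ : ContinuousOn β I) (hp : IsPartitionSeq t N s) (k : ℕ → ℕ)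
    {ω : Ω} (hω : ω ∈ alive τ t) {δ : ℝ} (hδ : 0 < δ) :
    ∀ᶠ n in atTop, ∀ j < N n * (k n + 1), 1 * |errorCoeff x τ g β (s n) (k n) j ω| ≤ δ := by
  obtain ⟨C, hC, hgC⟩ := (h.continuousOn_comp hg hω).exists_bound_Iic
  obtain ⟨η, hη, hβη⟩ := (h.continuousOn_comp hβ hω).exists_modulus_Iic (div_pos hδ hC)
  filter_upwards [hp.mesh η hη] with n hn j hj
  have hr := hp.refinePartition_le hj.le
  have hi : j / (k n + 1) < N n := (Nat.div_lt_iff_lt_mul (Nat.succ_pos _)).2 hj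
  have h1 := hgC _ (hp.le hi.le)
  have h2 := hβη _ _ (le_refinePartition (s n) (k n) j) hr
    ((_root_.refinePartition_le (hp.mono n) (k n) j).trans (hn _ hi))
  rw [one_mul, errorCoeff_eq hω hr, abs_mul]
  calc _ ≤ C * (δ / C) := by gcongr
    _ = δ := by field_simp

theorem sum_integral_sq_increment (hW : IsWienerProcess P ℱ W) {r : ℕ → ℝ≥0} (hr : Monotone r)
    (n : ℕ) :
    ∑ j ∈ Finset.range n, ∫ ω, (W (r (j + 1)) ω - W (r j) ω) ^ 2 ∂P = (r n : ℝ) - r 0 := by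
  rw [← Finset.sum_range_sub (fun j => (r j : ℝ))]
  exact Finset.sum_congr rfl fun j _ => hW.integral_sq_increment (hr (Nat.le_succ j))

theorem IsPartitionSeq.sum_integral_sq_le (hp : IsPartitionSeq t N s) (hW : IsWienerProcess P ℱ W)
    (k : ℕ → ℕ) (n : ℕ) :
    ∑ j ∈ Finset.range (N n * (k n + 1)), ∫ ω, (W (refinePartition (s n) (k n) (j + 1)) ω
      - W (refinePartition (s n) (k n) j) ω) ^ 2 ∂P ≤ (t : ℝ) * 1 ^ 2 := by
  rw [sum_integral_sq_increment hW (refinePartition_monotone (hp.mono n) (k n)),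
    refinePartition_mul, hp.finish]
  have := (refinePartition (s n) (k n) 0).coe_nonneg
  linarith

/-- For each n the errors are limits of `refinedError`. Along any choice of refinements the double
sum is one sum of small predictable coefficients times Wiener increments, so the diagonal lemma
applies. -/
theorem tendstoInMeasure_sum_mul_eulerError (hW : IsWienerProcess P ℱ W)
    (h : IsAdaptedPath ℱ I x τ) (hI : IsOpen I) {f α β g : ℝ → ℝ} (hα : ContinuousOn α I)
    (hβ : ContinuousOn β I) (hg : ContinuousOn g I) (hf : HasItoDifferential P W x τ f α β)
    (hp : IsPartitionSeq t N s) :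
    TendstoInMeasure (P.restrict (alive τ t)) (fun n ω => ∑ i ∈ Finset.range (N n),
      g (x (s n i) ω) * eulerError W x f α β (s n) i ω) atTop (fun _ => 0) := by
  have := hW.isProbabilityMeasure
  refine tendstoInMeasure_zero_of_diagonal (F := fun n m ω => ∑ i ∈ Finset.range (N n),
      g (x (s n i) ω) * refinedError W x β (s n) m i ω) ?_ ?_
  · intro n
    refine tendstoInMeasure_of_subseq (κ := Fin (N n))
      (X := fun i m => refinedError W x β (s n) m i)
      (Y := fun i => eulerError W x f α β (s n) i)
      (fun i => tendstoInMeasure_refinedError hW h hI hα hβ hf (hp.mono n) (hp.start n)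
        (hp.le i.2)) ?_ ?_
    · intro m
      refine Finset.aestronglyMeasurable_fun_sum _ fun i hi => ?_
      have hi' := Finset.mem_range.1 hi
      exact (h.aestronglyMeasurable hI hg (hp.le hi'.le) P).mul
        (refinedError_aestronglyMeasurable hW h hI hβ (hp.mono n) (hp.le hi') m)
    · refine ae_of_all _ fun ω ns _ hX => tendsto_finsetSum _ fun i hi => ?_
      exact (hX ⟨i, Finset.mem_range.1 hi⟩).const_mul _
  · intro k
    have key := tendstoInMeasure_sum_mul (P := P) (h.measurableSet_alive t)
      (m := fun n j => ℱ (refinePartition (s n) (k n) j))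
      (fun n i j hij => ℱ.mono (refinePartition_monotone (hp.mono n) (k n) hij))
      (fun n j => ℱ.le _)
      (ξ := fun n => errorCoeff x τ g β (s n) (k n))
      (D := fun n j ω => W (refinePartition (s n) (k n) (j + 1)) ω
        - W (refinePartition (s n) (k n) j) ω)
      (fun n j => measurable_errorCoeff h hI hg hβ (s n) (k n) j)
      (fun n j => hW.measurable_increment (refinePartition_monotone (hp.mono n) _ (Nat.le_succ j)))
      (fun n j => hW.memLp_increment (refinePartition_monotone (hp.mono n) _ (Nat.le_succ j)) 2)
      (fun n j => hW.indep _ _ (refinePartition_monotone (hp.mono n) _ (Nat.le_succ j)))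
      (fun n j => hW.integral_increment (refinePartition_monotone (hp.mono n) _ (Nat.le_succ j)))
      (N := fun n => N n * (k n + 1)) (c := fun _ => 1) (fun _ => one_pos) t.coe_nonneg
      (hp.sum_integral_sq_le hW k)
      (fun ω hω δ hδ => errorCoeff_eventually_le h hg hβ hp k hω hδ)
    refine key.congr_left fun n => ?_
    refine (ae_restrict_iff' (h.measurableSet_alive t)).2 (ae_of_all _ fun ω hω => ?_)
    simp only
    rw [Finset.sum_range_mul_eq_sum_sum]
    refine Finset.sum_congr rfl fun i hi => ?_
    rw [refinedError, Finset.mul_sum]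
    refine Finset.sum_congr rfl fun l hl => ?_
    have hi' := Finset.mem_range.1 hi
    have hl' := Finset.mem_range.1 hl
    have hj : i * (k n + 1) + l ≤ N n * (k n + 1) := by
      have := Nat.mul_le_mul_right (k n + 1) hi'
      rw [Nat.succ_mul] at this
      omega
    have hd : (i * (k n + 1) + l) / (k n + 1) = i := by
      rw [mul_comm, Nat.mul_add_div (Nat.succ_pos _), Nat.div_eq_of_lt hl', add_zero]
    rw [errorCoeff_eq hω (hp.refinePartition_le hj), hd, mul_assoc]

theorem tendstoInMeasure_sum_sq_eulerError (hW : IsWienerProcess P ℱ W)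
    (h : IsAdaptedPath ℱ I x τ) (hI : IsOpen I) {f α β : ℝ → ℝ} (hα : ContinuousOn α I)
    (hβ : ContinuousOn β I) (hf : HasItoDifferential P W x τ f α β)
    (hp : IsPartitionSeq t N s) :
    TendstoInMeasure (P.restrict (alive τ t)) (fun n ω => ∑ i ∈ Finset.range (N n),
      eulerError W x f α β (s n) i ω ^ 2) atTop (fun _ => 0) := by
  have := hW.isProbabilityMeasure
  refine tendstoInMeasure_zero_of_diagonal (F := fun n m ω => ∑ i ∈ Finset.range (N n),
      refinedError W x β (s n) m i ω ^ 2) ?_ ?_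
  · intro n
    refine tendstoInMeasure_of_subseq (κ := Fin (N n))
      (X := fun i m => refinedError W x β (s n) m i)
      (Y := fun i => eulerError W x f α β (s n) i)
      (fun i => tendstoInMeasure_refinedError hW h hI hα hβ hf (hp.mono n) (hp.start n)
        (hp.le i.2)) ?_ ?_
    · intro m
      refine Finset.aestronglyMeasurable_fun_sum _ fun i hi => ?_
      exact (refinedError_aestronglyMeasurable hW h hI hβ (hp.mono n)
        (hp.le (Finset.mem_range.1 hi)) m).pow 2
    · refine ae_of_all _ fun ω ns _ hX => tendsto_finsetSum _ fun i hi => ?_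
      exact (hX ⟨i, Finset.mem_range.1 hi⟩).pow 2
  · intro k
    have key := tendstoInMeasure_sum_sq_sum (P := P) (h.measurableSet_alive t)
      (m := fun n j => ℱ (refinePartition (s n) (k n) j))
      (fun n i j hij => ℱ.mono (refinePartition_monotone (hp.mono n) (k n) hij))
      (fun n j => ℱ.le _)
      (ξ := fun n => errorCoeff x τ (fun _ => 1) β (s n) (k n))
      (D := fun n j ω => W (refinePartition (s n) (k n) (j + 1)) ω
        - W (refinePartition (s n) (k n) j) ω)
      (fun n j => measurable_errorCoeff h hI continuousOn_const hβ (s n) (k n) j)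
      (fun n j => hW.measurable_increment (refinePartition_monotone (hp.mono n) _ (Nat.le_succ j)))
      (fun n j => hW.memLp_increment (refinePartition_monotone (hp.mono n) _ (Nat.le_succ j)) 2)
      (fun n j => hW.indep _ _ (refinePartition_monotone (hp.mono n) _ (Nat.le_succ j)))
      (fun n j => hW.integral_increment (refinePartition_monotone (hp.mono n) _ (Nat.le_succ j)))
      (N := N) (M := fun n => k n + 1) (c := fun _ => 1) (fun _ => one_pos) t.coe_nonneg
      (hp.sum_integral_sq_le hW k)
      (fun ω hω δ hδ => errorCoeff_eventually_le h continuousOn_const hβ hp k hω hδ)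
    refine key.congr_left fun n => ?_
    refine (ae_restrict_iff' (h.measurableSet_alive t)).2 (ae_of_all _ fun ω hω => ?_)
    refine Finset.sum_congr rfl fun i hi => ?_
    rw [refinedError]
    congr 1
    refine Finset.sum_congr rfl fun l hl => ?_
    have hi' := Finset.mem_range.1 hi
    have hl' := Finset.mem_range.1 hl
    have hj : i * (k n + 1) + l ≤ N n * (k n + 1) := by
      have := Nat.mul_le_mul_right (k n + 1) hi'
      rw [Nat.succ_mul] at this
      omega
    have hd : (i * (k n + 1) + l) / (k n + 1) = i := by
      rw [mul_comm, Nat.mul_add_div (Nat.succ_pos _), Nat.div_eq_of_lt hl', add_zero]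
    rw [errorCoeff_eq hω (hp.refinePartition_le hj), hd, one_mul]

theorem IsPartitionSeq.sum_sub (hp : IsPartitionSeq t N s) (n : ℕ) :
    ∑ i ∈ Finset.range (N n), ((s n (i + 1) : ℝ) - s n i) = t := by
  rw [Finset.sum_range_sub (fun i => (s n i : ℝ)), hp.finish, hp.start]
  simp

theorem IsPartitionSeq.sub_nonneg (hp : IsPartitionSeq t N s) (n i : ℕ) :
    0 ≤ (s n (i + 1) : ℝ) - s n i :=
  _root_.sub_nonneg.2 (NNReal.coe_le_coe.2 (hp.mono n (Nat.le_succ i)))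

theorem IsPartitionSeq.tendsto_sum_sq (hp : IsPartitionSeq t N s) :
    Tendsto (fun n => ∑ i ∈ Finset.range (N n), ((s n (i + 1) : ℝ) - s n i) ^ 2) atTop (𝓝 0) := by
  rw [Metric.tendsto_atTop']
  intro ε hε
  obtain ⟨δ, hδ, hδε⟩ : ∃ δ : ℝ≥0, 0 < δ ∧ (δ : ℝ) * t < ε := by
    refine ⟨⟨ε / (t + 1), by positivity⟩, show (0 : ℝ) < ε / (t + 1) by positivity, ?_⟩
    change ε / (t + 1) * t < ε
    rw [div_mul_eq_mul_div, div_lt_iff₀ (by positivity)]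
    nlinarith
  obtain ⟨n₀, hn₀⟩ := eventually_atTop.1 (hp.mesh δ hδ)
  refine ⟨n₀, fun n hn => ?_⟩
  rw [Real.dist_eq, sub_zero, abs_of_nonneg (Finset.sum_nonneg fun i _ => sq_nonneg _)]
  refine lt_of_le_of_lt ?_ hδε
  rw [← hp.sum_sub n, Finset.mul_sum]
  refine Finset.sum_le_sum fun i hi => ?_
  have h1 : (s n (i + 1) : ℝ) ≤ s n i + δ :=
    NNReal.coe_le_coe.2 (hn₀ n (le_of_lt hn) i (Finset.mem_range.1 hi))
  have h2 := hp.sub_nonneg n i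
  rw [sq]
  exact mul_le_mul_of_nonneg_right (by linarith) h2

/-- The compensated squares are centred innovations whose total variance is a constant times ∑
(Δt)², which vanishes with the mesh; the coefficients need only be bounded along each path. -/
theorem tendstoInMeasure_sum_mul_sq_increment (hW : IsWienerProcess P ℱ W)
    (h : IsAdaptedPath ℱ I x τ) (hI : IsOpen I) {g : ℝ → ℝ} (hg : ContinuousOn g I)
    (hp : IsPartitionSeq t N s) :
    TendstoInMeasure (P.restrict (alive τ t)) (fun n ω => ∑ i ∈ Finset.range (N n),
      g (x (s n i) ω) * ((W (s n (i + 1)) ω - W (s n i) ω) ^ 2 - ((s n (i + 1) : ℝ) - s n i)))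
      atTop (fun _ => 0) := by
  have := hW.isProbabilityMeasure
  set q : ℕ → ℝ := fun n => ∑ i ∈ Finset.range (N n), ((s n (i + 1) : ℝ) - s n i) ^ 2 with hq
  have hq0 : ∀ n, 0 ≤ q n := fun n => Finset.sum_nonneg fun i _ => sq_nonneg _
  -- The added 1/(n+1) keeps the scale positive even if all intervals are trivial, as for t = 0.
  set c : ℕ → ℝ := fun n => √(q n + 1 / ((n : ℝ) + 1)) with hc
  have hcpos : ∀ n, 0 < c n := fun n => Real.sqrt_pos.2 (by have := hq0 n; positivity)
  have hcsq : ∀ n, c n ^ 2 = q n + 1 / ((n : ℝ) + 1) := fun n =>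
    Real.sq_sqrt (by have := hq0 n; positivity)
  have hc0 : Tendsto c atTop (𝓝 0) := by
    have h1 := hp.tendsto_sum_sq.add (tendsto_one_div_add_atTop_nhds_zero_nat (𝕜 := ℝ))
    have h2 := (Real.continuous_sqrt.tendsto _).comp h1
    rw [add_zero, Real.sqrt_zero] at h2
    exact h2
  set C : ℝ := ∫ z, (z ^ 2 - 1) ^ 2 ∂(gaussianReal 0 1) with hC
  have hCnn : 0 ≤ C := integral_nonneg fun z => sq_nonneg _
  have key := tendstoInMeasure_sum_mul (P := P) (h.measurableSet_alive t)
    (m := fun n j => ℱ (s n j)) (fun n i j hij => ℱ.mono (hp.mono n hij)) (fun n j => ℱ.le _)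
    (ξ := fun n j => (alive τ (s n j)).indicator (fun ω => g (x (s n j) ω)))
    (D := fun n j ω => (W (s n (j + 1)) ω - W (s n j) ω) ^ 2 - ((s n (j + 1) : ℝ) - s n j))
    (fun n j => h.measurable_indicator hI hg le_rfl)
    (fun n j => ((hW.measurable_increment (hp.mono n (Nat.le_succ j))).pow_const 2).sub_const _)
    (fun n j => hW.memLp_sq_increment (hp.mono n (Nat.le_succ j)))
    (fun n j => hW.indep_sq_increment (hp.mono n (Nat.le_succ j)))
    (fun n j => hW.integral_sq_increment_sub (hp.mono n (Nat.le_succ j)))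
    (N := N) hcpos hCnn (by
      intro n
      rw [Finset.sum_congr rfl fun j _ =>
        hW.integral_sq_sub_sq_increment (hp.mono n (Nat.le_succ j)), ← Finset.sum_mul, mul_comm,
        hcsq]
      gcongr
      have : (0 : ℝ) ≤ 1 / ((n : ℝ) + 1) := by positivity
      change q n ≤ _
      linarith) (by
      intro ω hω δ hδ
      obtain ⟨B, hB, hgB⟩ := (h.continuousOn_comp hg hω).exists_bound_Iic
      filter_upwards [hc0.eventually (gt_mem_nhds (div_pos hδ hB))] with n hn j hj
      have hj' := hp.le (n := n) hj.le
      rw [Set.indicator_of_mem (alive_anti τ hj' hω)]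
      calc _ ≤ δ / B * B := mul_le_mul hn.le (hgB _ hj') (abs_nonneg _) (by positivity)
        _ = δ := by field_simp)
  refine key.congr_left fun n => ?_
  refine (ae_restrict_iff' (h.measurableSet_alive t)).2 (ae_of_all _ fun ω hω => ?_)
  refine Finset.sum_congr rfl fun i hi => ?_
  rw [Set.indicator_of_mem (alive_anti τ (hp.le (Finset.mem_range.1 hi).le) hω)]

end Errors

/-! ### Taylor expansion and Riemann sums along a fixed path. -/

section Deterministic

theorem ContDiffOn.deriv_one {f : ℝ → ℝ} {I : Set ℝ} (hI : IsOpen I) (hf : ContDiffOn ℝ 2 f I) :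
    ContDiffOn ℝ 1 (deriv f) I :=
  hf.deriv_of_isOpen hI (by norm_num)

theorem ContDiffOn.continuousOn_deriv_deriv {f : ℝ → ℝ} {I : Set ℝ} (hI : IsOpen I)
    (hf : ContDiffOn ℝ 2 f I) : ContinuousOn (deriv (deriv f)) I :=
  (hf.deriv_one hI).continuousOn_deriv_of_isOpen hI le_rfl

theorem ContDiffOn.hasDerivAt_of_isOpen {f : ℝ → ℝ} {I : Set ℝ} (hI : IsOpen I)
    (hf : ContDiffOn ℝ 1 f I) {z : ℝ} (hz : z ∈ I) : HasDerivAt f (deriv f z) z :=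
  ((hf.differentiableOn one_ne_zero).differentiableAt (hI.mem_nhds hz)).hasDerivAt

/-- Second-order Taylor expansion with the remainder bounded by the oscillation of the second
derivative. -/
theorem abs_taylor_two_le {f : ℝ → ℝ} {I : Set ℝ} (hI : IsOpen I) (hf : ContDiffOn ℝ 2 f I)
    {p q η : ℝ} (hpq : Set.uIcc p q ⊆ I)
    (hη : ∀ z ∈ Set.uIcc p q, |deriv (deriv f) z - deriv (deriv f) p| ≤ η) :
    |f q - f p - deriv f p * (q - p) - 1 / 2 * deriv (deriv f) p * (q - p) ^ 2|
      ≤ η * (q - p) ^ 2 := by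
  have hη0 : 0 ≤ η := (abs_nonneg _).trans (hη p Set.left_mem_uIcc)
  have hd1 : ∀ z ∈ Set.uIcc p q, HasDerivAt f (deriv f z) z := fun z hz =>
    (hf.of_le (by norm_num)).hasDerivAt_of_isOpen hI (hpq hz)
  have hd2 : ∀ z ∈ Set.uIcc p q, HasDerivAt (deriv f) (deriv (deriv f) z) z := fun z hz =>
    (hf.deriv_one hI).hasDerivAt_of_isOpen hI (hpq hz)
  have hpz : ∀ z ∈ Set.uIcc p q, |z - p| ≤ |q - p| := fun z hz => Set.abs_sub_left_of_mem_uIcc hz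
  -- The mean value inequality is used twice, first for f' and then for f; this loses the factor 1/2
  -- in the remainder, which is harmless.
  have h1 : ∀ z ∈ Set.uIcc p q,
      ‖deriv f z - deriv f p - deriv (deriv f) p * (z - p)‖ ≤ η * |q - p| := by
    intro z hz
    have := (convex_uIcc p q).norm_image_sub_le_of_norm_hasDerivWithin_le
      (f := fun z => deriv f z - deriv (deriv f) p * (z - p))
      (f' := fun z => deriv (deriv f) z - deriv (deriv f) p) (C := η)
      (fun z hz => by
        have := (hd2 z hz).sub (((hasDerivAt_id z).sub_const p).const_mul (deriv (deriv f) p))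
        exact (this.congr_deriv (by simp)).hasDerivWithinAt)
      hη Set.left_mem_uIcc hz
    have h2 : η * ‖z - p‖ ≤ η * |q - p| := by
      gcongr
      exact hpz z hz
    refine le_trans (le_of_eq ?_) (this.trans h2)
    congr 1
    ring
  have := (convex_uIcc p q).norm_image_sub_le_of_norm_hasDerivWithin_le
      (f := fun z => f z - deriv f p * (z - p) - 1 / 2 * deriv (deriv f) p * (z - p) ^ 2)
      (f' := fun z => deriv f z - deriv f p - deriv (deriv f) p * (z - p)) (C := η * |q - p|)
      (fun z hz => by
        have h3 := ((hasDerivAt_id z).sub_const p)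
        have := ((hd1 z hz).sub (h3.const_mul (deriv f p))).sub
          ((h3.pow 2).const_mul (1 / 2 * deriv (deriv f) p))
        refine (this.congr_deriv ?_).hasDerivWithinAt
        simp
        ring)
      h1 Set.left_mem_uIcc Set.right_mem_uIcc
  rw [Real.norm_eq_abs, Real.norm_eq_abs, mul_assoc η, abs_mul_abs_self] at this
  refine le_trans (le_of_eq ?_) (this.trans (le_of_eq ?_))
  · congr 1
    ring
  · ring

variable {t : ℝ≥0} {N : ℕ → ℕ} {s : ℕ → ℕ → ℝ≥0}

/-- Riemann–Stieltjes sums of a continuous function against an indefinite integral. -/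
theorem IsPartitionSeq.tendsto_sum_mul_integral (hp : IsPartitionSeq t N s) {φ ψ : ℝ≥0 → ℝ}
    (hφ : ContinuousOn φ (Set.Iic t)) (hψ : ContinuousOn ψ (Set.Iic t)) :
    Tendsto (fun n => ∑ i ∈ Finset.range (N n),
      φ (s n i) * ∫ r in (s n i : ℝ)..(s n (i + 1) : ℝ), ψ r.toNNReal) atTop
      (𝓝 (∫ r in (0 : ℝ)..(t : ℝ), φ r.toNNReal * ψ r.toNNReal)) := by
  rw [Metric.tendsto_atTop']
  intro ε hε
  obtain ⟨C, hC, hψC⟩ := hψ.exists_bound_Iic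
  obtain ⟨δ, hδ, hδε⟩ : ∃ δ : ℝ, 0 < δ ∧ δ * C * t < ε := by
    refine ⟨ε / (C * t + 1), by positivity, ?_⟩
    rw [div_mul_eq_mul_div, div_mul_eq_mul_div, div_lt_iff₀ (by positivity)]
    nlinarith
  obtain ⟨η, hη, hφη⟩ := hφ.exists_modulus_Iic hδ
  obtain ⟨n₀, hn₀⟩ := eventually_atTop.1 (hp.mesh η hη)
  refine ⟨n₀, fun n hn => ?_⟩
  have hle : ∀ i ≤ N n, (s n i : ℝ) ≤ t := fun i hi => NNReal.coe_le_coe.2 (hp.le hi)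
  have hsum := intervalIntegral.sum_integral_adjacent_intervals (μ := volume)
    (f := fun r : ℝ => φ r.toNNReal * ψ r.toNNReal) (a := fun i => (s n i : ℝ)) (n := N n)
    (fun i hi => (hφ.mul hψ).intervalIntegrable_toNNReal (hle i hi.le) (hle (i + 1) hi))
  rw [hp.start, hp.finish, NNReal.coe_zero] at hsum
  rw [← hsum, Real.dist_eq, ← Finset.sum_sub_distrib]
  refine lt_of_le_of_lt ((Finset.abs_sum_le_sum_abs _ _).trans ?_) hδε
  rw [← hp.sum_sub n, Finset.mul_sum]
  refine Finset.sum_le_sum fun i hi => ?_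
  have hi' := Finset.mem_range.1 hi
  have hmono : (s n i : ℝ) ≤ s n (i + 1) := NNReal.coe_le_coe.2 (hp.mono n (Nat.le_succ i))
  have hφψ : IntervalIntegrable (fun r : ℝ => φ r.toNNReal * ψ r.toNNReal) volume
      (s n i : ℝ) (s n (i + 1)) :=
    (hφ.mul hψ).intervalIntegrable_toNNReal (hle i hi'.le) (hle (i + 1) hi')
  rw [← intervalIntegral.integral_const_mul, ← intervalIntegral.integral_sub
    ((hψ.intervalIntegrable_toNNReal (hle i hi'.le) (hle (i + 1) hi')).const_mul _) hφψ]
  have hb := intervalIntegral.norm_integral_le_of_norm_le_const (C := δ * C)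
    (a := (s n i : ℝ)) (b := s n (i + 1))
    (f := fun r : ℝ => φ (s n i) * ψ r.toNNReal - φ r.toNNReal * ψ r.toNNReal) (by
      intro r hr
      rw [Set.uIoc_of_le hmono] at hr
      have hr1 : s n i ≤ r.toNNReal := NNReal.le_toNNReal_of_coe_le hr.1.le
      have hr2 : r.toNNReal ≤ s n (i + 1) := Real.toNNReal_le_iff_le_coe.2 hr.2
      have hr3 : r.toNNReal ≤ t := hr2.trans (hp.le hi')
      have h1 := hφη _ _ hr1 hr3 (hr2.trans (hn₀ n (le_of_lt hn) i hi'))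
      rw [← sub_mul, norm_mul]
      rw [abs_sub_comm] at h1
      exact mul_le_mul h1 (hψC _ hr3) (norm_nonneg _) hδ.le)
  rw [abs_of_nonneg (hp.sub_nonneg n i)] at hb
  exact hb

theorem IsPartitionSeq.tendsto_riemannSum (hp : IsPartitionSeq t N s) {φ : ℝ≥0 → ℝ}
    (hφ : ContinuousOn φ (Set.Iic t)) :
    Tendsto (fun n => ∑ i ∈ Finset.range (N n), φ (s n i) * ((s n (i + 1) : ℝ) - s n i)) atTop
      (𝓝 (∫ r in (0 : ℝ)..(t : ℝ), φ r.toNNReal)) := by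
  simpa using hp.tendsto_sum_mul_integral hφ (ψ := fun _ => 1) continuousOn_const

theorem IsPartitionSeq.tendsto_sum_sq_integral (hp : IsPartitionSeq t N s) {ψ : ℝ≥0 → ℝ}
    (hψ : ContinuousOn ψ (Set.Iic t)) :
    Tendsto (fun n => ∑ i ∈ Finset.range (N n),
      (∫ r in (s n i : ℝ)..(s n (i + 1) : ℝ), ψ r.toNNReal) ^ 2) atTop (𝓝 0) := by
  obtain ⟨C, hC, hψC⟩ := hψ.exists_bound_Iic
  have h1 := hp.tendsto_sum_sq.const_mul (C ^ 2)
  rw [mul_zero] at h1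
  refine squeeze_zero (fun n => Finset.sum_nonneg fun i _ => sq_nonneg _) (fun n => ?_) h1
  rw [Finset.mul_sum]
  refine Finset.sum_le_sum fun i hi => ?_
  have hmono : (s n i : ℝ) ≤ s n (i + 1) := NNReal.coe_le_coe.2 (hp.mono n (Nat.le_succ i))
  have hb := intervalIntegral.norm_integral_le_of_norm_le_const (C := C)
    (a := (s n i : ℝ)) (b := s n (i + 1)) (f := fun r : ℝ => ψ r.toNNReal) (by
      intro r hr
      rw [Set.uIoc_of_le hmono] at hr
      exact hψC _ ((Real.toNNReal_le_iff_le_coe.2 hr.2).trans (hp.le (Finset.mem_range.1 hi))))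
  rw [← mul_pow, ← sq_abs]
  rw [abs_of_nonneg (hp.sub_nonneg n i)] at hb
  gcongr
  exact hb

theorem tendsto_sum_sq_add {p q : ℕ → ℕ → ℝ}
    (hp : Tendsto (fun n => ∑ i ∈ Finset.range (N n), p n i ^ 2) atTop (𝓝 0))
    (hq : Tendsto (fun n => ∑ i ∈ Finset.range (N n), q n i ^ 2) atTop (𝓝 0)) :
    Tendsto (fun n => ∑ i ∈ Finset.range (N n), (p n i + q n i) ^ 2) atTop (𝓝 0) := by
  have h1 := (hp.add hq).const_mul 2
  rw [add_zero, mul_zero] at h1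
  refine squeeze_zero (fun n => Finset.sum_nonneg fun i _ => sq_nonneg _) (fun n => ?_) h1
  rw [← Finset.sum_add_distrib, Finset.mul_sum]
  refine Finset.sum_le_sum fun i _ => ?_
  nlinarith [sq_nonneg (p n i - q n i)]

/-- Weighted sums of squares do not change in the limit under a perturbation that is small in the
sense of sums of squares. -/
theorem tendsto_sum_mul_add_sq {φ p e : ℕ → ℕ → ℝ} {C L L' : ℝ}
    (hφ : ∀ n, ∀ i < N n, |φ n i| ≤ C)
    (he : Tendsto (fun n => ∑ i ∈ Finset.range (N n), e n i ^ 2) atTop (𝓝 0))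
    (hp : Tendsto (fun n => ∑ i ∈ Finset.range (N n), p n i ^ 2) atTop (𝓝 L'))
    (hφp : Tendsto (fun n => ∑ i ∈ Finset.range (N n), φ n i * p n i ^ 2) atTop (𝓝 L)) :
    Tendsto (fun n => ∑ i ∈ Finset.range (N n), φ n i * (p n i + e n i) ^ 2) atTop (𝓝 L) := by
  have hbound : ∀ n, |∑ i ∈ Finset.range (N n), φ n i * (2 * (p n i * e n i) + e n i ^ 2)|
      ≤ C * (2 * (√(∑ i ∈ Finset.range (N n), p n i ^ 2) * √(∑ i ∈ Finset.range (N n), e n i ^ 2))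
        + ∑ i ∈ Finset.range (N n), e n i ^ 2) := by
    intro n
    -- For an empty sum nothing forces C to be nonnegative.
    rcases Nat.eq_zero_or_pos (N n) with h0 | h0
    · simp [h0]
    have hC : 0 ≤ C := (abs_nonneg _).trans (hφ n 0 h0)
    refine (Finset.abs_sum_le_sum_abs _ _).trans ?_
    have h1 : ∀ i ∈ Finset.range (N n), |φ n i * (2 * (p n i * e n i) + e n i ^ 2)|
        ≤ C * (2 * (|p n i| * |e n i|) + e n i ^ 2) := by
      intro i hi
      rw [abs_mul]
      refine mul_le_mul (hφ n i (Finset.mem_range.1 hi)) ?_ (abs_nonneg _) hC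
      refine (abs_add_le _ _).trans ?_
      rw [abs_mul, abs_mul, abs_pow, sq_abs, abs_two]
    refine (Finset.sum_le_sum h1).trans ?_
    rw [← Finset.mul_sum, Finset.sum_add_distrib, ← Finset.mul_sum]
    -- Cauchy–Schwarz: the cross terms vanish because the sums of p² converge and those of e² tend
    -- to zero.
    have h2 := Real.sum_mul_le_sqrt_mul_sqrt (Finset.range (N n)) (fun i => |p n i|)
      (fun i => |e n i|)
    simp only [sq_abs] at h2
    gcongr
  have hlim : Tendsto (fun n => C * (2 * (√(∑ i ∈ Finset.range (N n), p n i ^ 2)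
      * √(∑ i ∈ Finset.range (N n), e n i ^ 2)) + ∑ i ∈ Finset.range (N n), e n i ^ 2)) atTop
      (𝓝 0) := by
    have h1 := ((((hp.sqrt).mul (he.sqrt)).const_mul 2).add he).const_mul C
    simpa using h1
  have h0 := (squeeze_zero_norm hbound hlim).add hφp
  rw [zero_add] at h0
  refine h0.congr fun n => ?_
  rw [← Finset.sum_add_distrib]
  exact Finset.sum_congr rfl fun i _ => by ring

/-- The path up to t fills a compact interval inside I, where f'' is uniformly continuous. The
remainders are therefore at most η times the squared increments, whose sums stay bounded because
they converge to L. -/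
theorem IsPartitionSeq.tendsto_taylor_two (hp : IsPartitionSeq t N s) {f : ℝ → ℝ} {I : Set ℝ}
    (hI : IsOpen I) (hf : ContDiffOn ℝ 2 f I) {y : ℝ≥0 → ℝ} (hy : ContinuousOn y (Set.Iic t))
    (hyI : ∀ r ≤ t, y r ∈ I) {L : ℝ}
    (hL : Tendsto (fun n => ∑ i ∈ Finset.range (N n), (y (s n (i + 1)) - y (s n i)) ^ 2) atTop
      (𝓝 L)) :
    Tendsto (fun n => ∑ i ∈ Finset.range (N n), (f (y (s n (i + 1))) - f (y (s n i))
      - deriv f (y (s n i)) * (y (s n (i + 1)) - y (s n i))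
      - 1 / 2 * deriv (deriv f) (y (s n i)) * (y (s n (i + 1)) - y (s n i)) ^ 2)) atTop (𝓝 0) := by
  have hK : IsCompact (y '' Set.Iic t) := (isCompact_Iic_nnreal t).image_of_continuousOn hy
  have hKc : (y '' Set.Iic t).OrdConnected :=
    (isPreconnected_Iic.image y hy).ordConnected
  have hKI : y '' Set.Iic t ⊆ I := by rintro _ ⟨r, hr, rfl⟩; exact hyI r hr
  have hu := hK.uniformContinuousOn_of_continuous ((hf.continuousOn_deriv_deriv hI).mono hKI)
  rw [Metric.tendsto_atTop']
  intro ε hε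
  have hL0 : 0 ≤ L := ge_of_tendsto' hL fun n => Finset.sum_nonneg fun i _ => sq_nonneg _
  obtain ⟨η, hη, hηε⟩ : ∃ η : ℝ, 0 < η ∧ η * (L + 1) < ε :=
    ⟨ε / (2 * (L + 1)), by positivity, by field_simp; norm_num⟩
  obtain ⟨δ, hδ, hδη⟩ := Metric.uniformContinuousOn_iff_le.1 hu η hη
  obtain ⟨θ, hθ, hyθ⟩ := hy.exists_modulus_Iic hδ
  obtain ⟨n₀, hn₀⟩ := eventually_atTop.1 ((hp.mesh θ hθ).and
    (hL.eventually (gt_mem_nhds (lt_add_one L))))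
  refine ⟨n₀, fun n hn => ?_⟩
  obtain ⟨hn1, hn2⟩ := hn₀ n (le_of_lt hn)
  rw [Real.dist_eq, sub_zero]
  refine lt_of_le_of_lt (Finset.abs_sum_le_sum_abs _ _) (lt_of_le_of_lt ?_ hηε)
  refine le_trans ?_ (mul_le_mul_of_nonneg_left hn2.le hη.le)
  rw [Finset.mul_sum]
  refine Finset.sum_le_sum fun i hi => ?_
  have hi' := Finset.mem_range.1 hi
  have hm1 : y (s n i) ∈ y '' Set.Iic t := ⟨_, hp.le hi'.le, rfl⟩
  have hm2 : y (s n (i + 1)) ∈ y '' Set.Iic t := ⟨_, hp.le hi', rfl⟩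
  have hsub := hKc.uIcc_subset hm1 hm2
  refine abs_taylor_two_le hI hf (hsub.trans hKI) fun z hz => ?_
  refine hδη z (hsub hz) _ hm1 ?_
  rw [Real.dist_eq]
  exact (Set.abs_sub_left_of_mem_uIcc hz).trans
    (hyθ _ _ (hp.mono n (Nat.le_succ i)) (hp.le hi') (hn1 i hi'))

end Deterministic

/-! ### Itô's formula. -/

section ItoFormula

variable {Ω : Type*} {mΩ : MeasurableSpace Ω} {P : Measure Ω} {ℱ : Filtration ℝ≥0 mΩ}
  {W x : ℝ≥0 → Ω → ℝ} {I : Set ℝ} {τ : Ω → WithTop ℝ≥0} {t : ℝ≥0} {N : ℕ → ℕ} {s : ℕ → ℕ → ℝ≥0}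

/-- The pathwise limit of `∑ g(x) (ΔW)²` is `∫ g(x) dt` wherever the compensated sums vanish. -/
theorem IsPartitionSeq.tendsto_sum_mul_sq_increment (hp : IsPartitionSeq t N s)
    (h : IsAdaptedPath ℱ I x τ) {g : ℝ → ℝ} (hg : ContinuousOn g I) {ω : Ω} (hω : ω ∈ alive τ t)
    (h0 : Tendsto (fun n => ∑ i ∈ Finset.range (N n), g (x (s n i) ω) *
      ((W (s n (i + 1)) ω - W (s n i) ω) ^ 2 - ((s n (i + 1) : ℝ) - s n i))) atTop (𝓝 0)) :
    Tendsto (fun n => ∑ i ∈ Finset.range (N n), g (x (s n i) ω) *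
      (W (s n (i + 1)) ω - W (s n i) ω) ^ 2) atTop
      (𝓝 (∫ r in (0 : ℝ)..(t : ℝ), g (x r.toNNReal ω))) := by
  have h1 := h0.add (hp.tendsto_riemannSum (h.continuousOn_comp hg hω))
  rw [zero_add] at h1
  refine h1.congr fun n => ?_
  rw [← Finset.sum_add_distrib]
  exact Finset.sum_congr rfl fun i _ => by ring

/-- The pathwise sums of squares of the increments of `f(x) - ∫ β(x) dW` vanish in the limit. -/
theorem IsPartitionSeq.tendsto_sum_sq_sub (hp : IsPartitionSeq t N s)
    (h : IsAdaptedPath ℱ I x τ) {f α β : ℝ → ℝ} (hα : ContinuousOn α I) {ω : Ω}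
    (hω : ω ∈ alive τ t)
    (h0 : Tendsto (fun n => ∑ i ∈ Finset.range (N n), eulerError W x f α β (s n) i ω ^ 2) atTop
      (𝓝 0)) :
    Tendsto (fun n => ∑ i ∈ Finset.range (N n), (f (x (s n (i + 1)) ω) - f (x (s n i) ω)
      - β (x (s n i) ω) * (W (s n (i + 1)) ω - W (s n i) ω)) ^ 2) atTop (𝓝 0) := by
  have h1 := tendsto_sum_sq_add h0 (hp.tendsto_sum_sq_integral (h.continuousOn_comp hα hω))
  refine h1.congr fun n => Finset.sum_congr rfl fun i _ => ?_
  rw [eulerError]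
  ring

/-- Sum the Taylor expansion over the partition. In the first-order term Δx splits into ∫ a dt, bΔW
and the Euler error; in the second-order term (Δx)² may be replaced by (bΔW)², whose weighted sums
become integrals in time. What is left over is the sum of b f' ΔW. -/
theorem IsPartitionSeq.ito_pathwise (hp : IsPartitionSeq t N s) (h : IsAdaptedPath ℱ I x τ)
    (hI : IsOpen I) {a b f : ℝ → ℝ} (ha : ContinuousOn a I) (hb : ContinuousOn b I)
    (hf : ContDiffOn ℝ 2 f I) {ω : Ω} (hω : ω ∈ alive τ t)
    (h1 : Tendsto (fun n => ∑ i ∈ Finset.range (N n),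
      deriv f (x (s n i) ω) * eulerError W x (fun z => z) a b (s n) i ω) atTop (𝓝 0))
    (h2 : Tendsto (fun n => ∑ i ∈ Finset.range (N n),
      eulerError W x (fun z => z) a b (s n) i ω ^ 2) atTop (𝓝 0))
    (h3 : Tendsto (fun n => ∑ i ∈ Finset.range (N n),
      (deriv (deriv f) (x (s n i) ω) * b (x (s n i) ω) ^ 2) *
      ((W (s n (i + 1)) ω - W (s n i) ω) ^ 2 - ((s n (i + 1) : ℝ) - s n i))) atTop (𝓝 0))
    (h4 : Tendsto (fun n => ∑ i ∈ Finset.range (N n), b (x (s n i) ω) ^ 2 *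
      ((W (s n (i + 1)) ω - W (s n i) ω) ^ 2 - ((s n (i + 1) : ℝ) - s n i))) atTop (𝓝 0)) :
    Tendsto (fun n => ∑ i ∈ Finset.range (N n), b (x (s n i) ω) * deriv f (x (s n i) ω) *
      (W (s n (i + 1)) ω - W (s n i) ω)) atTop
      (𝓝 (f (x t ω) - f (x 0 ω) - ∫ r in (0 : ℝ)..(t : ℝ),
        (a (x r.toNNReal ω) * deriv f (x r.toNNReal ω)
          + 1 / 2 * b (x r.toNNReal ω) ^ 2 * deriv (deriv f) (x r.toNNReal ω)))) := by
  have hf1 : ContinuousOn (deriv f) I := (hf.deriv_one hI).continuousOn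
  have hf2 : ContinuousOn (deriv (deriv f)) I := hf.continuousOn_deriv_deriv hI
  have hE := hp.tendsto_sum_sq_sub (W := W) (f := fun z => z) (β := b) h ha hω h2
  have hQ : Tendsto (fun n => ∑ i ∈ Finset.range (N n),
      (b (x (s n i) ω) * (W (s n (i + 1)) ω - W (s n i) ω)) ^ 2) atTop
      (𝓝 (∫ r in (0 : ℝ)..(t : ℝ), b (x r.toNNReal ω) ^ 2)) := by
    refine (hp.tendsto_sum_mul_sq_increment h (hb.pow 2) hω h4).congr fun n => ?_
    exact Finset.sum_congr rfl fun i _ => by rw [mul_pow]; rfl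
  have hφQ : Tendsto (fun n => ∑ i ∈ Finset.range (N n), deriv (deriv f) (x (s n i) ω) *
      (b (x (s n i) ω) * (W (s n (i + 1)) ω - W (s n i) ω)) ^ 2) atTop
      (𝓝 (∫ r in (0 : ℝ)..(t : ℝ), deriv (deriv f) (x r.toNNReal ω) * b (x r.toNNReal ω) ^ 2)) := by
    refine (hp.tendsto_sum_mul_sq_increment (g := fun z => deriv (deriv f) z * b z ^ 2) h
      (hf2.mul (hb.pow 2)) hω h3).congr fun n => ?_
    exact Finset.sum_congr rfl fun i _ => by rw [mul_pow]; ring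
  obtain ⟨C, -, hC⟩ := (h.continuousOn_comp hf2 hω).exists_bound_Iic
  -- Weight 1 gives the quadratic variation of x, needed to control the Taylor remainder; weight f''
  -- gives the Itô correction.
  have hsq1 := tendsto_sum_mul_add_sq (φ := fun _ _ => 1) (C := 1) (by simp) hE hQ
    (by simpa using hQ)
  have hsq2 := tendsto_sum_mul_add_sq (φ := fun n i => deriv (deriv f) (x (s n i) ω))
    (fun n i hi => hC _ (hp.le hi.le)) hE hQ hφQ
  simp only [add_sub_cancel, one_mul] at hsq1 hsq2
  have hT := hp.tendsto_taylor_two hI hf (y := fun r => x r ω)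
    (h.continuousOn_comp continuousOn_id hω) (fun r hr => h.mem ω r (alive_anti τ hr hω)) hsq1
  have hA := hp.tendsto_sum_mul_integral (h.continuousOn_comp hf1 hω) (h.continuousOn_comp ha hω)
  have hlim := (((tendsto_const_nhds (x := f (x t ω) - f (x 0 ω))).sub hT).sub
    (hsq2.const_mul (1 / 2))).sub (hA.add h1)
  have e : f (x t ω) - f (x 0 ω) - (∫ r in (0 : ℝ)..(t : ℝ),
        (a (x r.toNNReal ω) * deriv f (x r.toNNReal ω)
          + 1 / 2 * b (x r.toNNReal ω) ^ 2 * deriv (deriv f) (x r.toNNReal ω)))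
      = f (x t ω) - f (x 0 ω) - 0 - 1 / 2 * (∫ r in (0 : ℝ)..(t : ℝ),
        deriv (deriv f) (x r.toNNReal ω) * b (x r.toNNReal ω) ^ 2)
        - ((∫ r in (0 : ℝ)..(t : ℝ), deriv f (x r.toNNReal ω) * a (x r.toNNReal ω)) + 0) := by
    have i1 := (h.continuousOn_comp (ha.mul hf1) hω).intervalIntegrable_toNNReal
      t.coe_nonneg le_rfl
    have i2 := (h.continuousOn_comp ((continuousOn_const (c := (1 / 2 : ℝ))).mul
      (hf2.mul (hb.pow 2))) hω).intervalIntegrable_toNNReal t.coe_nonneg le_rfl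
    have := intervalIntegral.integral_add i1 i2
    simp only [Pi.mul_apply, Pi.pow_apply] at this
    rw [intervalIntegral.integral_const_mul] at this
    have e2 : ∀ r : ℝ, a (x r.toNNReal ω) * deriv f (x r.toNNReal ω)
          + 1 / 2 * b (x r.toNNReal ω) ^ 2 * deriv (deriv f) (x r.toNNReal ω)
        = a (x r.toNNReal ω) * deriv f (x r.toNNReal ω)
          + 1 / 2 * (deriv (deriv f) (x r.toNNReal ω) * b (x r.toNNReal ω) ^ 2) :=
      fun r => by ring
    simp only [e2, mul_comm (deriv f _)]
    rw [this]
    ring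
  rw [e]
  refine hlim.congr fun n => ?_
  have htel := Finset.sum_range_sub (fun i => f (x (s n i) ω)) (N n)
  simp only [hp.finish, hp.start] at htel
  rw [← htel, Finset.mul_sum, ← Finset.sum_sub_distrib, ← Finset.sum_sub_distrib,
    ← Finset.sum_add_distrib, ← Finset.sum_sub_distrib]
  refine Finset.sum_congr rfl fun i _ => ?_
  rw [eulerError]
  ring

/-- **Itô formula.** -/
theorem HasItoDifferential.ito {a b : ℝ → ℝ} (hx : HasItoDifferential P W x τ (fun z => z) a b)
    (hW : IsWienerProcess P ℱ W) (h : IsAdaptedPath ℱ I x τ) (hI : IsOpen I)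
    (ha : ContinuousOn a I) (hb : ContinuousOn b I) {f : ℝ → ℝ} (hf : ContDiffOn ℝ 2 f I) :
    HasItoDifferential P W x τ f
      (fun z => a z * deriv f z + 1 / 2 * b z ^ 2 * deriv (deriv f) z)
      (fun z => b z * deriv f z) := by
  have := hW.isProbabilityMeasure
  intro t N s hp
  have hf1 : ContinuousOn (deriv f) I := (hf.deriv_one hI).continuousOn
  have hf2 : ContinuousOn (deriv (deriv f)) I := hf.continuousOn_deriv_deriv hI
  let X : Fin 4 → ℕ → Ω → ℝ := ![
    fun n ω => ∑ i ∈ Finset.range (N n),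
      deriv f (x (s n i) ω) * eulerError W x (fun z => z) a b (s n) i ω,
    fun n ω => ∑ i ∈ Finset.range (N n), eulerError W x (fun z => z) a b (s n) i ω ^ 2,
    fun n ω => ∑ i ∈ Finset.range (N n), (deriv (deriv f) (x (s n i) ω) * b (x (s n i) ω) ^ 2) *
      ((W (s n (i + 1)) ω - W (s n i) ω) ^ 2 - ((s n (i + 1) : ℝ) - s n i)),
    fun n ω => ∑ i ∈ Finset.range (N n), b (x (s n i) ω) ^ 2 *
      ((W (s n (i + 1)) ω - W (s n i) ω) ^ 2 - ((s n (i + 1) : ℝ) - s n i))]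
  have hX : ∀ k, TendstoInMeasure (P.restrict (alive τ t)) (X k) atTop (fun _ => 0) := by
    intro k
    fin_cases k
    · exact tendstoInMeasure_sum_mul_eulerError hW h hI ha hb hf1 hx hp
    · exact tendstoInMeasure_sum_sq_eulerError hW h hI ha hb hx hp
    · exact tendstoInMeasure_sum_mul_sq_increment hW h hI
        (g := fun z => deriv (deriv f) z * b z ^ 2) (hf2.mul (hb.pow 2)) hp
    · exact tendstoInMeasure_sum_mul_sq_increment hW h hI (g := fun z => b z ^ 2) (hb.pow 2) hp
  refine tendstoInMeasure_of_subseq hX (fun n => ?_) ?_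
  · refine Finset.aestronglyMeasurable_fun_sum _ fun i hi => ?_
    have hWm : ∀ r, AEStronglyMeasurable (W r) (P.restrict (alive τ t)) := fun r =>
      ((hW.measurable r).mono (ℱ.le r) le_rfl).aestronglyMeasurable
    exact (h.aestronglyMeasurable hI (hb.mul hf1) (hp.le (Finset.mem_range.1 hi).le) P).mul
      ((hWm _).sub (hWm _))
  · refine (ae_restrict_iff' (h.measurableSet_alive t)).2 (ae_of_all _ fun ω hω ns hns hk => ?_)
    exact (hp.comp hns).ito_pathwise h hI ha hb hf hω (hk 0) (hk 1) (hk 2) (hk 3)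

end ItoFormula

/-! ### Uniqueness of drift and volatility. -/

section Uniqueness

theorem exists_isPartitionSeq (t : ℝ≥0) : ∃ N s, IsPartitionSeq t N s := by
  have hs : Monotone (fun j : ℕ => if j = 0 then (0 : ℝ≥0) else t) := by
    intro i j hij
    by_cases hi : i = 0
    · simp [hi]
    · have hj : j ≠ 0 := by omega
      simp [hi, hj]
  exact ⟨_, _, by simpa using isPartitionSeq_refinePartition hs (by simp) 1⟩

theorem WithTop.exists_rat_btwn {t : ℝ≥0} {σ : WithTop ℝ≥0} (h : (t : WithTop ℝ≥0) < σ) :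
    ∃ q : ℚ, t < Real.toNNReal q ∧ ((Real.toNNReal q : ℝ≥0) : WithTop ℝ≥0) < σ := by
  induction σ with
  | top =>
    obtain ⟨q, -, hq, -⟩ := (NNReal.lt_iff_exists_rat_btwn t (t + 1)).1 (lt_add_one t)
    exact ⟨q, hq, WithTop.coe_lt_top _⟩
  | coe σ =>
    obtain ⟨q, -, hq, hq'⟩ := (NNReal.lt_iff_exists_rat_btwn t σ).1 (WithTop.coe_lt_coe.1 h)
    exact ⟨q, hq, WithTop.coe_lt_coe.2 hq'⟩

theorem ContinuousOn.eq_zero_of_integral_eq_zero {t : ℝ≥0} {φ : ℝ≥0 → ℝ}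
    (hφ : ContinuousOn φ (Set.Iic t)) (h0 : ∀ r, 0 ≤ φ r)
    (hint : ∫ r in (0 : ℝ)..(t : ℝ), φ r.toNNReal = 0) {r : ℝ≥0} (hr : r < t) : φ r = 0 := by
  by_contra hne
  have hpos : 0 < φ r := lt_of_le_of_ne (h0 r) (Ne.symm hne)
  have ht : (0 : ℝ) < t := lt_of_le_of_lt r.coe_nonneg (NNReal.coe_lt_coe.2 hr)
  have := intervalIntegral.integral_pos ht
    (hφ.comp_toNNReal.mono fun _ h => h.2) (fun z _ => h0 _)
    ⟨r, ⟨r.coe_nonneg, NNReal.coe_le_coe.2 hr.le⟩, by simpa using hpos⟩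
  exact this.ne' hint

/-- Positivity at r would persist on an interval to its right, and between two rational times there
the integral would be positive, yet it is a difference of zeros. Rational times suffice, so a single
null set can serve all times. -/
theorem ContinuousOn.nonpos_of_integral_rat_eq_zero {t : ℝ≥0} {φ : ℝ≥0 → ℝ}
    (hφ : ContinuousOn φ (Set.Iic t))
    (hint : ∀ q : ℚ, Real.toNNReal q < t →
      ∫ r in (0 : ℝ)..(Real.toNNReal q : ℝ≥0), φ r.toNNReal = 0)
    {r : ℝ≥0} (hr : r < t) : φ r ≤ 0 := by
  by_contra! hpos
  obtain ⟨η, hη, hmod⟩ := hφ.exists_modulus_Iic (half_pos hpos)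
  have hrm : r < min (r + η) t := lt_min (lt_add_of_pos_right r hη) hr
  obtain ⟨q, -, hq1, hq2⟩ := (NNReal.lt_iff_exists_rat_btwn _ _).1 hrm
  obtain ⟨p, -, hp1, hp2⟩ := (NNReal.lt_iff_exists_rat_btwn _ _).1 hq1
  have hqt : Real.toNNReal q < t := hq2.trans_le (min_le_right _ _)
  have hpt : Real.toNNReal p < t := hp2.trans hqt
  have hz : ∫ r in ((Real.toNNReal p : ℝ≥0) : ℝ)..(Real.toNNReal q : ℝ≥0), φ r.toNNReal = 0 := by
    rw [← intervalIntegral.integral_interval_sub_left (a := 0)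
      (hφ.intervalIntegrable_toNNReal t.coe_nonneg (NNReal.coe_le_coe.2 hqt.le))
      (hφ.intervalIntegrable_toNNReal t.coe_nonneg (NNReal.coe_le_coe.2 hpt.le)),
      hint q hqt, hint p hpt, sub_zero]
  have hφpos : ∀ z : ℝ, (Real.toNNReal p : ℝ) ≤ z → z ≤ (Real.toNNReal q : ℝ) →
      0 < φ z.toNNReal := by
    intro z hz1 hz2
    have h1 : Real.toNNReal p ≤ z.toNNReal := NNReal.le_toNNReal_of_coe_le hz1
    have h2 : z.toNNReal ≤ Real.toNNReal q := Real.toNNReal_le_iff_le_coe.2 hz2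
    have := hmod r z.toNNReal (hp1.le.trans h1) (h2.trans hqt.le)
      (h2.trans (hq2.le.trans (min_le_left _ _)))
    linarith [(abs_le.1 this).1]
  have hpq : ((Real.toNNReal p : ℝ≥0) : ℝ) < (Real.toNNReal q : ℝ≥0) := NNReal.coe_lt_coe.2 hp2
  have := intervalIntegral.integral_pos hpq
    (hφ.comp_toNNReal.mono fun _ h => h.2.trans (NNReal.coe_le_coe.2 hqt.le))
    (fun z hz => (hφpos z hz.1.le hz.2).le) ⟨_, ⟨le_rfl, hpq.le⟩, hφpos _ le_rfl hpq.le⟩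
  exact this.ne' hz

theorem ContinuousOn.eq_zero_of_integral_rat_eq_zero {t : ℝ≥0} {φ : ℝ≥0 → ℝ}
    (hφ : ContinuousOn φ (Set.Iic t))
    (hint : ∀ q : ℚ, Real.toNNReal q < t →
      ∫ r in (0 : ℝ)..(Real.toNNReal q : ℝ≥0), φ r.toNNReal = 0)
    {r : ℝ≥0} (hr : r < t) : φ r = 0 := by
  refine le_antisymm (hφ.nonpos_of_integral_rat_eq_zero hint hr) ?_
  have := (hφ.neg).nonpos_of_integral_rat_eq_zero (fun q hq => by
    simp only [Pi.neg_apply, intervalIntegral.integral_neg, hint q hq, neg_zero]) hr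
  simpa using this

variable {Ω : Type*} {mΩ : MeasurableSpace Ω} {P : Measure Ω} {ℱ : Filtration ℝ≥0 mΩ}
  {W x : ℝ≥0 → Ω → ℝ} {I : Set ℝ} {τ : Ω → WithTop ℝ≥0} {f α α' β β' : ℝ → ℝ}

theorem HasItoDifferential.congr (hf : HasItoDifferential P W x τ f α β)
    (h : IsStoppingTime ℱ τ)
    (hae : ∀ᵐ ω ∂P, ∀ t : ℝ≥0, (t : WithTop ℝ≥0) < τ ω →
      α (x t ω) = α' (x t ω) ∧ β (x t ω) = β' (x t ω)) :
    HasItoDifferential P W x τ f α' β' := by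
  intro t N s hp
  have hae' : ∀ᵐ ω ∂(P.restrict (alive τ t)), ∀ r ≤ t,
      α (x r ω) = α' (x r ω) ∧ β (x r ω) = β' (x r ω) := by
    refine (ae_restrict_iff' (ℱ.le t _ (h.measurableSet_alive t))).2 ?_
    filter_upwards [hae] with ω h1 hω r hr using h1 r (alive_anti τ hr hω)
  refine TendstoInMeasure.congr (fun n => ?_) ?_ (hf t N s hp)
  · filter_upwards [hae'] with ω hω
    refine Finset.sum_congr rfl fun i hi => ?_
    rw [(hω _ (hp.le (Finset.mem_range.1 hi).le)).2]
  · filter_upwards [hae'] with ω hω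
    congr 1
    refine intervalIntegral.integral_congr fun r hr => (hω _ ?_).1
    rw [Set.uIcc_of_le t.coe_nonneg] at hr
    exact Real.toNNReal_le_iff_le_coe.2 hr.2

/-- Both Δf - βΔW and Δf - β'ΔW have vanishing sums of squares, hence so does their difference (β -
β')ΔW up to sign. But these sums converge to ∫ (β - β')² dt, which is thus zero, and the integrand
is continuous. -/
theorem HasItoDifferential.volatility_unique (hf : HasItoDifferential P W x τ f α β)
    (hf' : HasItoDifferential P W x τ f α' β') (hW : IsWienerProcess P ℱ W)
    (h : IsAdaptedPath ℱ I x τ) (hI : IsOpen I) (hα : ContinuousOn α I) (hα' : ContinuousOn α' I)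
    (hβ : ContinuousOn β I) (hβ' : ContinuousOn β' I) :
    ∀ᵐ ω ∂P, ∀ t : ℝ≥0, (t : WithTop ℝ≥0) < τ ω → β (x t ω) = β' (x t ω) := by
  have key : ∀ t : ℝ≥0, ∀ᵐ ω ∂P, ω ∈ alive τ t → ∀ r < t, β (x r ω) = β' (x r ω) := by
    intro t
    obtain ⟨N, s, hp⟩ := exists_isPartitionSeq t
    have hg : ContinuousOn (fun z => (β z - β' z) ^ 2) I := (hβ.sub hβ').pow 2
    let X : Fin 3 → ℕ → Ω → ℝ := ![
      fun n ω => ∑ i ∈ Finset.range (N n), eulerError W x f α β (s n) i ω ^ 2,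
      fun n ω => ∑ i ∈ Finset.range (N n), eulerError W x f α' β' (s n) i ω ^ 2,
      fun n ω => ∑ i ∈ Finset.range (N n), (β (x (s n i) ω) - β' (x (s n i) ω)) ^ 2 *
        ((W (s n (i + 1)) ω - W (s n i) ω) ^ 2 - ((s n (i + 1) : ℝ) - s n i))]
    have hX : ∀ k, TendstoInMeasure (P.restrict (alive τ t)) (X k) atTop (fun _ => 0) := by
      intro k
      fin_cases k
      · exact tendstoInMeasure_sum_sq_eulerError hW h hI hα hβ hf hp
      · exact tendstoInMeasure_sum_sq_eulerError hW h hI hα' hβ' hf' hp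
      · exact tendstoInMeasure_sum_mul_sq_increment hW h hI (g := fun z => (β z - β' z) ^ 2) hg hp
    obtain ⟨ns, hns, hae⟩ := exists_common_subseq_tendsto_ae hX
    filter_upwards [(ae_restrict_iff' (h.measurableSet_alive t)).1 hae] with ω hk hω r hr
    have hk := hk hω
    have hp' := hp.comp hns
    have h1 := hp'.tendsto_sum_sq_sub h hα hω (hk 0)
    have h2 := hp'.tendsto_sum_sq_sub h hα' hω (hk 1)
    have h3 := hp'.tendsto_sum_mul_sq_increment h hg hω (hk 2)
    have h2' : Tendsto (fun n => ∑ i ∈ Finset.range (N (ns n)),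
        (-(f (x (s (ns n) (i + 1)) ω) - f (x (s (ns n) i) ω)
          - β' (x (s (ns n) i) ω) * (W (s (ns n) (i + 1)) ω - W (s (ns n) i) ω))) ^ 2) atTop
        (𝓝 0) := by
      simpa only [neg_sq] using h2
    have h4 := tendsto_sum_sq_add h1 h2'
    have h5 := tendsto_nhds_unique h3 (h4.congr fun n => Finset.sum_congr rfl fun i _ => by ring)
    have h6 := (h.continuousOn_comp hg hω).eq_zero_of_integral_eq_zero
      (fun r => sq_nonneg _) h5 hr
    exact sub_eq_zero.1 (pow_eq_zero_iff two_ne_zero |>.1 h6)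
  -- One null set for all rational horizons; any time before τ lies below such a horizon.
  have hall : ∀ᵐ ω ∂P, ∀ q : ℚ, ω ∈ alive τ (Real.toNNReal q) →
      ∀ r < Real.toNNReal q, β (x r ω) = β' (x r ω) := ae_all_iff.2 fun q => key _
  filter_upwards [hall] with ω hω t ht
  obtain ⟨q, hq, hqτ⟩ := WithTop.exists_rat_btwn ht
  exact hω q hqτ t hq

/-- The drift and volatility of an Itô process are unique along its paths. -/
theorem HasItoDifferential.unique (hf : HasItoDifferential P W x τ f α β)
    (hf' : HasItoDifferential P W x τ f α' β') (hW : IsWienerProcess P ℱ W)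
    (h : IsAdaptedPath ℱ I x τ) (hI : IsOpen I) (hα : ContinuousOn α I) (hα' : ContinuousOn α' I)
    (hβ : ContinuousOn β I) (hβ' : ContinuousOn β' I) :
    ∀ᵐ ω ∂P, ∀ t : ℝ≥0, (t : WithTop ℝ≥0) < τ ω →
      α (x t ω) = α' (x t ω) ∧ β (x t ω) = β' (x t ω) := by
  have hvol := hf.volatility_unique hf' hW h hI hα hα' hβ hβ'
  -- With a common volatility both differentials involve the same Riemann sums, so uniqueness of
  -- limits in measure identifies the drift integrals.
  have hf'' : HasItoDifferential P W x τ f α β' := hf.congr h.isStoppingTime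
    (hvol.mono fun ω hω t ht => ⟨rfl, hω t ht⟩)
  have key : ∀ t : ℝ≥0, ∀ᵐ ω ∂P, ω ∈ alive τ t →
      ∫ r in (0 : ℝ)..(t : ℝ), (α (x r.toNNReal ω) - α' (x r.toNNReal ω)) = 0 := by
    intro t
    obtain ⟨N, s, hp⟩ := exists_isPartitionSeq t
    have := tendstoInMeasure_ae_unique (hf'' t N s hp) (hf' t N s hp)
    filter_upwards [(ae_restrict_iff' (h.measurableSet_alive t)).1 this] with ω h1 hω
    have h1 := h1 hω
    rw [intervalIntegral.integral_sub
      ((h.continuousOn_comp hα hω).intervalIntegrable_toNNReal t.coe_nonneg le_rfl)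
      ((h.continuousOn_comp hα' hω).intervalIntegrable_toNNReal t.coe_nonneg le_rfl)]
    linarith
  have hall : ∀ᵐ ω ∂P, ∀ q : ℚ, ω ∈ alive τ (Real.toNNReal q) →
      ∫ r in (0 : ℝ)..(Real.toNNReal q : ℝ≥0), (α (x r.toNNReal ω) - α' (x r.toNNReal ω)) = 0 :=
    ae_all_iff.2 fun q => key _
  filter_upwards [hall, hvol] with ω hω hv t ht
  refine ⟨?_, hv t ht⟩
  obtain ⟨q, hq, hqτ⟩ := WithTop.exists_rat_btwn ht
  have hc := h.continuousOn_comp (hα.sub hα') (t := Real.toNNReal q) hqτ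
  exact sub_eq_zero.1 (hc.eq_zero_of_integral_rat_eq_zero
    (fun p hp => hω p (alive_anti τ hp.le hqτ)) hq)

end Uniqueness

/-! ### The criterion along a single solution. -/

section Transformation

variable {Ω : Type*} {mΩ : MeasurableSpace Ω} {P : Measure Ω} {ℱ : Filtration ℝ≥0 mΩ}
  {W x : ℝ≥0 → Ω → ℝ} {I J : Set ℝ} {τ : Ω → WithTop ℝ≥0} {a b u : ℝ → ℝ} {aᵤ bᵤ : ℝ}

theorem IsAdaptedPath.comp (h : IsAdaptedPath ℱ I x τ) (hI : IsOpen I) (hu : ContinuousOn u I)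
    (huJ : Set.MapsTo u I J) : IsAdaptedPath ℱ J (fun t ω => u (x t ω)) τ where
  isStoppingTime := h.isStoppingTime
  adapted _ := (h.measurable_indicator hI hu le_rfl).stronglyMeasurable
  continuousOn ω := hu.comp (h.continuousOn ω) fun t ht => h.mem ω t ht
  mem ω t ht := huJ (h.mem ω t ht)

theorem isItoSolution_iff : IsItoSolution P ℱ W I a b x τ ↔
    IsAdaptedPath ℱ I x τ ∧ HasItoDifferential P W x τ (fun z => z) a b :=
  ⟨fun h => ⟨⟨h.isStoppingTime, h.adapted, h.continuousOn, h.mem⟩, h.sde⟩,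
    fun h => ⟨h.1.isStoppingTime, h.1.adapted, h.1.continuousOn, h.1.mem, h.2⟩⟩

theorem isBrownianWithDrift_comp_iff (h : IsAdaptedPath ℱ I x τ) (hI : IsOpen I)
    (hu : ContinuousOn u I) : IsBrownianWithDrift P ℱ W aᵤ bᵤ (fun t ω => u (x t ω)) τ ↔
      HasItoDifferential P W x τ u (fun _ => aᵤ) (fun _ => bᵤ) := by
  rw [IsBrownianWithDrift, isItoSolution_iff]
  exact ⟨fun h' => h'.2, fun h' => ⟨h.comp hI hu (Set.mapsTo_univ _ _), h'⟩⟩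

/-- Itô's formula gives one differential of u(x). Being Brownian with drift asserts another, so
uniqueness yields the equations; conversely the equations turn the first into the second. -/
theorem isBrownianWithDrift_iff_ae (hW : IsWienerProcess P ℱ W) (hI : IsOpen I)
    (ha : ContinuousOn a I) (hb : ContinuousOn b I) (hu : ContDiffOn ℝ 2 u I)
    (hx : IsItoSolution P ℱ W I a b x τ) :
    IsBrownianWithDrift P ℱ W aᵤ bᵤ (fun t ω => u (x t ω)) τ ↔
      ∀ᵐ ω ∂P, ∀ t : ℝ≥0, (t : WithTop ℝ≥0) < τ ω →
        aᵤ = a (x t ω) * deriv u (x t ω) + 1 / 2 * b (x t ω) ^ 2 * deriv (deriv u) (x t ω) ∧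
        bᵤ = b (x t ω) * deriv u (x t ω) := by
  obtain ⟨hpath, hdiff⟩ := isItoSolution_iff.1 hx
  have hu1 : ContinuousOn (deriv u) I := (hu.deriv_one hI).continuousOn
  have hu2 : ContinuousOn (deriv (deriv u)) I := hu.continuousOn_deriv_deriv hI
  have hito := hdiff.ito hW hpath hI ha hb hu
  rw [isBrownianWithDrift_comp_iff hpath hI hu.continuousOn]
  constructor
  · intro h
    exact h.unique hito hW hpath hI continuousOn_const
      ((ha.mul hu1).add ((continuousOn_const.mul (hb.pow 2)).mul hu2))
      continuousOn_const (hb.mul hu1)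
  · intro h
    exact hito.congr hpath.isStoppingTime (h.mono fun ω hω t ht =>
      ⟨(hω t ht).1.symm, (hω t ht).2.symm⟩)

end Transformation

/-! ### Exit times and Brownian motion with drift. -/

section Existence

variable {Ω : Type*} {mΩ : MeasurableSpace Ω} {P : Measure Ω} {ℱ : Filtration ℝ≥0 mΩ}
  {W Z : ℝ≥0 → Ω → ℝ} {J : Set ℝ}

open Classical in
/-- The first time at which the process `Z` is outside `J`. -/
noncomputable def exitTime (Z : ℝ≥0 → Ω → ℝ) (J : Set ℝ) (ω : Ω) : WithTop ℝ≥0 :=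
  if ∃ r, Z r ω ∉ J then ((sInf {r | Z r ω ∉ J} : ℝ≥0) : WithTop ℝ≥0) else ⊤

theorem lt_exitTime_iff (hJ : IsOpen J) {ω : Ω} (hZ : Continuous fun r => Z r ω) (t : ℝ≥0) :
    (t : WithTop ℝ≥0) < exitTime Z J ω ↔ ∀ r ≤ t, Z r ω ∈ J := by
  unfold exitTime
  split_ifs with h
  · rw [WithTop.coe_lt_coe]
    constructor
    · intro ht r hr
      by_contra hcon
      have : sInf {r | Z r ω ∉ J} ≤ r := csInf_le (OrderBot.bddBelow _) hcon
      exact absurd ht (not_lt.2 (this.trans hr))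
    · intro ht
      by_contra! hcon
      have hc : IsClosed {r | Z r ω ∉ J} := (hJ.preimage hZ).isClosed_compl
      exact hc.csInf_mem h (OrderBot.bddBelow _) (ht _ hcon)
  · push Not at h
    exact iff_of_true (WithTop.coe_lt_top t) fun r _ => h r

/-- By compactness of [0, t], a path stays in the open set J exactly when its distance to the
complement has a positive lower bound, and by continuity this bound can be checked at countably many
times before t. -/
theorem measurableSet_forall_le_mem (hJ : IsOpen J) (hZ : ∀ ω, Continuous fun r => Z r ω)
    (hm : ∀ t, Measurable[ℱ t] (Z t)) (t : ℝ≥0) :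
    MeasurableSet[ℱ t] {ω | ∀ r ≤ t, Z r ω ∈ J} := by
  -- `Metric.infDist` to the empty set is 0 by convention, so J = ℝ is treated apart.
  rcases (Jᶜ).eq_empty_or_nonempty with hempty | hne
  · rw [Set.compl_empty_iff] at hempty
    simp [hempty]
  let D : ℕ → Set.Iic t := TopologicalSpace.denseSeq (Set.Iic t)
  have e : {ω | ∀ r ≤ t, Z r ω ∈ J} = ⋃ k : ℕ, ⋂ n : ℕ,
      {ω | 1 / ((k : ℝ) + 1) ≤ Metric.infDist (Z (D n) ω) Jᶜ} := by
    ext ω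
    have hc : Continuous fun r => Metric.infDist (Z r ω) Jᶜ :=
      (Metric.continuous_infDist_pt _).comp (hZ ω)
    simp only [Set.mem_ofPred_eq, Set.mem_iUnion, Set.mem_iInter]
    constructor
    · intro h
      obtain ⟨r₀, hr₀, hmin⟩ := (isCompact_Iic_nnreal t).exists_isMinOn
        ⟨t, Set.self_mem_Iic⟩ hc.continuousOn
      have hpos : 0 < Metric.infDist (Z r₀ ω) Jᶜ :=
        (hJ.isClosed_compl.notMem_iff_infDist_pos hne).1 fun hcon => hcon (h r₀ hr₀)
      obtain ⟨k, hk⟩ := exists_nat_one_div_lt hpos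
      exact ⟨k, fun n => hk.le.trans (hmin (D n).2)⟩
    · rintro ⟨k, hk⟩ r hr
      have hall : ∀ r : Set.Iic t, 1 / ((k : ℝ) + 1) ≤ Metric.infDist (Z r ω) Jᶜ := fun r =>
        (TopologicalSpace.denseRange_denseSeq (Set.Iic t)).induction_on
          (p := fun r : Set.Iic t => 1 / ((k : ℝ) + 1) ≤ Metric.infDist (Z r ω) Jᶜ) r
          (isClosed_le continuous_const (hc.comp continuous_subtype_val)) hk
      by_contra hcon
      have h0 : Metric.infDist (Z r ω) Jᶜ = 0 := Metric.infDist_zero_of_mem hcon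
      have h1 := hall ⟨r, hr⟩
      have h2 : (0 : ℝ) < 1 / ((k : ℝ) + 1) := by positivity
      simp only at h1
      linarith
  rw [e]
  refine MeasurableSet.iUnion fun k => MeasurableSet.iInter fun n => ?_
  have hDm : Measurable[ℱ t] (Z (D n)) := (hm (D n)).mono (ℱ.mono (D n).2) le_rfl
  exact measurableSet_le measurable_const ((Metric.continuous_infDist_pt _).measurable.comp hDm)

theorem isAdaptedPath_exitTime (hJ : IsOpen J) (hZ : ∀ ω, Continuous fun r => Z r ω)
    (hm : ∀ t, Measurable[ℱ t] (Z t)) : IsAdaptedPath ℱ J Z (exitTime Z J) := by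
  have e : ∀ t, alive (exitTime Z J) t = {ω | ∀ r ≤ t, Z r ω ∈ J} := fun t => by
    ext ω; exact lt_exitTime_iff hJ (hZ ω) t
  refine ⟨fun t => ?_, fun t => ?_, fun ω => (hZ ω).continuousOn, fun ω t ht =>
    (lt_exitTime_iff hJ (hZ ω) t).1 ht t le_rfl⟩
  · have e' : {ω | exitTime Z J ω ≤ t} = (alive (exitTime Z J) t)ᶜ := by
      ext ω
      exact (not_lt (a := (t : WithTop ℝ≥0)) (b := exitTime Z J ω)).symm
    rw [e', e]
    exact (measurableSet_forall_le_mem hJ hZ hm t).compl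
  · rw [e]
    exact ((hm t).indicator (measurableSet_forall_le_mem hJ hZ hm t)).stronglyMeasurable

/-- A Brownian motion with drift that starts at `z`. -/
def driftedBrownian (W : ℝ≥0 → Ω → ℝ) (aᵤ bᵤ z : ℝ) (t : ℝ≥0) (ω : Ω) : ℝ :=
  z + aᵤ * t + bᵤ * (W t ω - W 0 ω)

/-- For a constant integrand the Riemann sums telescope and equal their limit for every partition.
-/
theorem hasItoDifferential_driftedBrownian (W : ℝ≥0 → Ω → ℝ) (aᵤ bᵤ z : ℝ)
    (τ : Ω → WithTop ℝ≥0) : HasItoDifferential P W (driftedBrownian W aᵤ bᵤ z) τ (fun z => z)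
      (fun _ => aᵤ) (fun _ => bᵤ) := by
  intro t N s hp ε hε
  refine tendsto_const_nhds.congr fun n => ?_
  symm
  convert measure_empty (μ := P.restrict {ω | (t : WithTop ℝ≥0) < τ ω}) using 2
  ext ω
  have htel := Finset.sum_range_sub (fun i => W (s n i) ω) (N n)
  simp only [hp.finish, hp.start] at htel
  have e : (∑ i ∈ Finset.range (N n), bᵤ * (W (s n (i + 1)) ω - W (s n i) ω))
      = driftedBrownian W aᵤ bᵤ z t ω - driftedBrownian W aᵤ bᵤ z 0 ω
        - ∫ r in (0 : ℝ)..(t : ℝ), aᵤ := by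
    rw [← Finset.mul_sum, htel]
    simp [driftedBrownian]
    ring
  simp only [Set.mem_ofPred_eq, Set.mem_empty_iff_false, iff_false, not_le]
  rw [e, edist_self]
  exact hε

theorem isAdaptedPath_driftedBrownian (hW : IsWienerProcess P ℱ W) (hJ : IsOpen J)
    (aᵤ bᵤ z : ℝ) : IsAdaptedPath ℱ J (driftedBrownian W aᵤ bᵤ z)
      (exitTime (driftedBrownian W aᵤ bᵤ z) J) := by
  refine isAdaptedPath_exitTime hJ (fun ω => ?_) fun t => ?_
  · have := hW.continuous ω
    unfold driftedBrownian
    fun_prop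
  · exact ((hW.measurable_increment (zero_le (a := t))).const_mul bᵤ).const_add _

end Existence

/-! ### Calculus on the interval: inverses, antiderivatives, consistency. -/

section Calculus

variable {I : Set ℝ} {a b u : ℝ → ℝ} {aᵤ bᵤ : ℝ}

theorem contDiffOn_two_of_hasDerivAt (hI : IsOpen I) {v v' : ℝ → ℝ}
    (hv : ∀ z ∈ I, HasDerivAt v (v' z) z) (hv' : ContDiffOn ℝ 1 v' I) : ContDiffOn ℝ 2 v I := by
  rw [show (2 : WithTop ℕ∞) = 1 + 1 by norm_num, contDiffOn_succ_iff_deriv_of_isOpen hI]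
  exact ⟨fun z hz => (hv z hz).differentiableAt.differentiableWithinAt, by simp,
    hv'.congr fun z hz => (hv z hz).deriv⟩

theorem contDiffOn_one_of_hasDerivAt (hI : IsOpen I) {v v' : ℝ → ℝ}
    (hv : ∀ z ∈ I, HasDerivAt v (v' z) z) (hv' : ContinuousOn v' I) : ContDiffOn ℝ 1 v I := by
  rw [show (1 : WithTop ℕ∞) = 0 + 1 by norm_num, contDiffOn_succ_iff_deriv_of_isOpen hI]
  exact ⟨fun z hz => (hv z hz).differentiableAt.differentiableWithinAt, by simp,
    contDiffOn_zero.2 (hv'.congr fun z hz => (hv z hz).deriv)⟩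

theorem Set.OrdConnected.forall_pos_or_forall_neg (hIc : I.OrdConnected) {g : ℝ → ℝ}
    (hg : ContinuousOn g I) (h0 : ∀ z ∈ I, g z ≠ 0) :
    (∀ z ∈ I, 0 < g z) ∨ ∀ z ∈ I, g z < 0 := by
  by_contra! hcon
  obtain ⟨⟨p, hp, hgp⟩, q, hq, hgq⟩ := hcon
  obtain ⟨z, hz, hgz⟩ := hIc.isPreconnected.intermediate_value hp hq hg ⟨hgp, hgq⟩
  exact h0 z hz hgz

theorem strictMonoOn_of_hasDerivAt_pos (hIo : IsOpen I) (hIc : I.OrdConnected) {v v' : ℝ → ℝ}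
    (hv : ∀ z ∈ I, HasDerivAt v (v' z) z) (hpos : ∀ z ∈ I, 0 < v' z) : StrictMonoOn v I :=
  strictMonoOn_of_deriv_pos hIc.convex (fun z hz => (hv z hz).continuousAt.continuousWithinAt)
    fun z hz => by
      rw [hIo.interior_eq] at hz
      rw [(hv z hz).deriv]
      exact hpos z hz

theorem strictAntiOn_of_hasDerivAt_neg (hIo : IsOpen I) (hIc : I.OrdConnected) {v v' : ℝ → ℝ}
    (hv : ∀ z ∈ I, HasDerivAt v (v' z) z) (hneg : ∀ z ∈ I, v' z < 0) : StrictAntiOn v I :=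
  strictAntiOn_of_deriv_neg hIc.convex (fun z hz => (hv z hz).continuousAt.continuousWithinAt)
    fun z hz => by
      rw [hIo.interior_eq] at hz
      rw [(hv z hz).deriv]
      exact hneg z hz

theorem strictMonoOn_or_strictAntiOn (hIo : IsOpen I) (hIc : I.OrdConnected) {v v' : ℝ → ℝ}
    (hv : ∀ z ∈ I, HasDerivAt v (v' z) z) (hv' : ContinuousOn v' I) (h0 : ∀ z ∈ I, v' z ≠ 0) :
    StrictMonoOn v I ∨ StrictAntiOn v I :=
  (hIc.forall_pos_or_forall_neg hv' h0).imp (strictMonoOn_of_hasDerivAt_pos hIo hIc hv)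
    (strictAntiOn_of_hasDerivAt_neg hIo hIc hv)

/-- A function on an open interval with continuous nonvanishing derivative is a
diffeomorphism onto an open set. -/
theorem exists_inverse_of_hasDerivAt (hIo : IsOpen I) (hIc : I.OrdConnected) {u' : ℝ → ℝ}
    (hu : ∀ z ∈ I, HasDerivAt u (u' z) z) (hu' : ContinuousOn u' I) (h0 : ∀ z ∈ I, u' z ≠ 0) :
    IsOpen (u '' I) ∧ ∃ v : ℝ → ℝ, (∀ z ∈ I, v (u z) = z) ∧
      ∀ z ∈ I, HasDerivAt v (u' z)⁻¹ (u z) := by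
  have hinj : Set.InjOn u I := (strictMonoOn_or_strictAntiOn hIo hIc hu hu' h0).elim
    (fun h => h.injOn) (fun h => h.injOn)
  have hu1 := contDiffOn_one_of_hasDerivAt hIo hu hu'
  have hstrict : ∀ z ∈ I, HasStrictDerivAt u (u' z) z := fun z hz =>
    (hu1.contDiffAt (hIo.mem_nhds hz)).hasStrictDerivAt' (hu z hz) one_ne_zero
  -- From the inverse function theorem; it gives at once that the image is open and that the inverse
  -- is continuous.
  have hmap : ∀ z ∈ I, map u (𝓝 z) = 𝓝 (u z) := fun z hz =>
    (hstrict z hz).map_nhds_eq (h0 z hz)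
  have hJ : IsOpen (u '' I) := by
    rw [isOpen_iff_mem_nhds]
    rintro _ ⟨z, hz, rfl⟩
    rw [← hmap z hz]
    exact image_mem_map (hIo.mem_nhds hz)
  have hleft : ∀ z ∈ I, Function.invFunOn u I (u z) = z := fun z hz => hinj.leftInvOn_invFunOn hz
  refine ⟨hJ, Function.invFunOn u I, hleft, fun z hz => ?_⟩
  have hcont : ContinuousAt (Function.invFunOn u I) (u z) := by
    rw [ContinuousAt, hleft z hz, ← hmap z hz, tendsto_map'_iff]
    refine tendsto_id.congr' ?_
    filter_upwards [hIo.mem_nhds hz] with y hy using (hleft y hy).symm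
  refine HasDerivAt.of_local_left_inverse (f := u) hcont (by rw [hleft z hz]; exact hu z hz)
    (h0 z hz) ?_
  filter_upwards [hJ.mem_nhds (Set.mem_image_of_mem u hz)]
  rintro _ ⟨y, hy, rfl⟩
  rw [hleft y hy]

theorem hasDerivAt_of_deriv_eq_div (hIo : IsOpen I) (hu : ContDiffOn ℝ 2 u I)
    (hu' : ∀ z ∈ I, deriv u z = bᵤ / b z) {z : ℝ} (hz : z ∈ I) : HasDerivAt u (bᵤ / b z) z := by
  rw [← hu' z hz]
  exact (hu.of_le (by norm_num)).hasDerivAt_of_isOpen hIo hz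

theorem contDiffOn_const_div (hb : ContDiffOn ℝ 1 b I) (hb0 : ∀ z ∈ I, b z ≠ 0) (c : ℝ) :
    ContDiffOn ℝ 1 (fun z => c / b z) I := contDiffOn_const.div hb hb0

theorem deriv_deriv_of_deriv_eq_div (hIo : IsOpen I) (hb : ContDiffOn ℝ 1 b I)
    (hb0 : ∀ z ∈ I, b z ≠ 0) (hu' : ∀ z ∈ I, deriv u z = bᵤ / b z) {z : ℝ} (hz : z ∈ I) :
    deriv (deriv u) z = -(bᵤ * deriv b z) / b z ^ 2 := by
  have h1 : deriv u =ᶠ[𝓝 z] fun z => bᵤ / b z := by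
    filter_upwards [hIo.mem_nhds hz] with y hy using hu' y hy
  rw [h1.deriv_eq]
  have h2 := (hasDerivAt_const z bᵤ).div (hb.hasDerivAt_of_isOpen hIo hz) (hb0 z hz)
  rw [zero_mul, zero_sub] at h2
  exact h2.deriv

/-- With u' = bᵤ/b and u'' = -bᵤ b'/b², the right side of the drift equation is (bᵤ/b)(a - b b'/2),
and the factor bᵤ/b can be inverted. -/
theorem drift_eq_iff (hbᵤ : bᵤ ≠ 0) {A B B' : ℝ} (hB : B ≠ 0) :
    aᵤ = A * (bᵤ / B) + 1 / 2 * B ^ 2 * (-(bᵤ * B') / B ^ 2) ↔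
      A = aᵤ / bᵤ * B + 1 / 2 * B * B' := by
  have e : A * (bᵤ / B) + 1 / 2 * B ^ 2 * (-(bᵤ * B') / B ^ 2)
      = bᵤ / B * (A - 1 / 2 * B * B') := by
    field_simp
    ring
  have e2 : A = aᵤ / bᵤ * B + 1 / 2 * B * B' ↔ A - 1 / 2 * B * B' = aᵤ / bᵤ * B := by
    constructor <;> intro h <;> linarith
  rw [e, e2]
  constructor
  · intro h
    rw [h]
    field_simp
  · intro h
    rw [h]
    field_simp

theorem hasDerivAt_integral_div (hIo : IsOpen I) (hIc : I.OrdConnected)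
    (hb : ContDiffOn ℝ 1 b I) (hb0 : ∀ z ∈ I, b z ≠ 0) (c : ℝ) {x₀ z : ℝ} (hx₀ : x₀ ∈ I)
    (hz : z ∈ I) : HasDerivAt (fun z => ∫ y in x₀..z, c / b y) (c / b z) z := by
  have hc := (contDiffOn_const_div hb hb0 c).continuousOn
  exact intervalIntegral.integral_hasDerivAt_right
    (hc.mono (hIc.uIcc_subset hx₀ hz)).intervalIntegrable
    (hc.stronglyMeasurableAtFilter hIo z hz) (hc.continuousAt (hIo.mem_nhds hz))

theorem contDiffOn_integral_div (hIo : IsOpen I) (hIc : I.OrdConnected)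
    (hb : ContDiffOn ℝ 1 b I) (hb0 : ∀ z ∈ I, b z ≠ 0) (c : ℝ) {x₀ : ℝ} (hx₀ : x₀ ∈ I) :
    ContDiffOn ℝ 2 (fun z => ∫ y in x₀..z, c / b y) I :=
  contDiffOn_two_of_hasDerivAt hIo (fun _ hz => hasDerivAt_integral_div hIo hIc hb hb0 c hx₀ hz)
    (contDiffOn_const_div hb hb0 c)

end Calculus

/-! ### Solutions by transformation, and the main theorem. -/

section Main

variable {Ω : Type*} {mΩ : MeasurableSpace Ω} {P : Measure Ω} {ℱ : Filtration ℝ≥0 mΩ}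
  {W : ℝ≥0 → Ω → ℝ} {I : Set ℝ} {a b u : ℝ → ℝ} {aᵤ bᵤ : ℝ}

/-- Under the consistency condition the dynamic is a transformed Brownian motion with drift, and so
can be started everywhere. -/
theorem exists_isItoSolution (hW : IsWienerProcess P ℱ W) (hIo : IsOpen I)
    (hIc : I.OrdConnected) (hb : ContDiffOn ℝ 1 b I) (hb0 : ∀ z ∈ I, b z ≠ 0) (hbᵤ : bᵤ ≠ 0)
    (ha : ∀ z ∈ I, a z = aᵤ / bᵤ * b z + 1 / 2 * b z * deriv b z)
    {u : ℝ → ℝ} (hu : ∀ z ∈ I, HasDerivAt u (bᵤ / b z) z) {y : ℝ} (hy : y ∈ I) :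
    ∃ (x : ℝ≥0 → Ω → ℝ) (τ : Ω → WithTop ℝ≥0), IsItoSolution P ℱ W I a b x τ ∧
      ∀ᵐ ω ∂P, 0 < τ ω ∧ x 0 ω = y := by
  obtain ⟨hJ, v, hvu, hv⟩ := exists_inverse_of_hasDerivAt hIo hIc hu
    (contDiffOn_const_div hb hb0 bᵤ).continuousOn fun z hz => div_ne_zero hbᵤ (hb0 z hz)
  set J := u '' I with hJdef
  have hvI : Set.MapsTo v J I := by
    rintro _ ⟨z, hz, rfl⟩
    rwa [hvu z hz]
  have hvd : ∀ z ∈ J, HasDerivAt v (b (v z) / bᵤ) z := by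
    rintro _ ⟨z, hz, rfl⟩
    rw [hvu z hz, ← inv_div]
    exact hv z hz
  have hvc : ContinuousOn v J := fun z hz => (hvd z hz).continuousAt.continuousWithinAt
  -- Bootstrap from v' = b(v)/bᵤ: v is continuous, hence C¹, hence C² because b is C¹.
  have hv1 : ContDiffOn ℝ 1 v J := contDiffOn_one_of_hasDerivAt hJ hvd
    ((hb.continuousOn.comp hvc hvI).div_const _)
  have hv2 : ContDiffOn ℝ 2 v J := contDiffOn_two_of_hasDerivAt hJ hvd
    ((hb.comp hv1 hvI).div_const _)
  have hvdd : ∀ z ∈ J, deriv (deriv v) z = deriv b (v z) * (b (v z) / bᵤ) / bᵤ := by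
    intro z hz
    have h1 : deriv v =ᶠ[𝓝 z] fun z => b (v z) / bᵤ := by
      filter_upwards [hJ.mem_nhds hz] with w hw using (hvd w hw).deriv
    rw [h1.deriv_eq]
    exact (((hb.hasDerivAt_of_isOpen hIo (hvI hz)).comp z (hvd z hz)).div_const bᵤ).deriv
  set Z := driftedBrownian W aᵤ bᵤ (u y) with hZ
  have hpath : IsAdaptedPath ℱ J Z (exitTime Z J) := isAdaptedPath_driftedBrownian hW hJ aᵤ bᵤ (u y)
  have hito := (hasItoDifferential_driftedBrownian (P := P) W aᵤ bᵤ (u y) (exitTime Z J)).ito hW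
    hpath hJ continuousOn_const continuousOn_const hv2
  -- This holds for every ω, since `driftedBrownian` uses W - W 0 instead of relying on W 0 = 0
  -- almost surely.
  have hZ0 : ∀ ω, Z 0 ω = u y := fun ω => by simp [hZ, driftedBrownian]
  refine ⟨fun t ω => v (Z t ω), exitTime Z J, isItoSolution_iff.2 ⟨hpath.comp hJ hvc hvI, ?_⟩, ?_⟩
  · have hc : HasItoDifferential P W Z (exitTime Z J) v (fun z => a (v z)) (fun z => b (v z)) := by
      -- Itô's formula for v gives drift (aᵤ/bᵤ) b + b b'/2 and volatility b at v(Z); consistency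
      -- says that this drift is a.
      refine hito.congr hpath.isStoppingTime (ae_of_all _ fun ω t ht => ?_)
      have hz := hpath.mem ω t ht
      rw [(hvd _ hz).deriv, hvdd _ hz, ha _ (hvI hz)]
      constructor
      · field_simp
      · exact mul_div_cancel₀ _ hbᵤ
    exact hc
  · refine ae_of_all _ fun ω => ⟨?_, ?_⟩
    · have hcont : Continuous fun r => Z r ω := by
        have := hW.continuous ω
        simp only [hZ]
        unfold driftedBrownian
        fun_prop
      refine (lt_exitTime_iff hJ hcont 0).2 fun r hr => ?_
      rw [le_antisymm hr zero_le, hZ0]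
      exact Set.mem_image_of_mem u hy
    · simp only [hZ0]
      exact hvu y hy

/-- Necessity uses the solutions started at each point, read at time 0. For sufficiency, u itself is
the diffeomorphism that carries a Brownian motion with drift back to such solutions. -/
theorem mapsToBrownian_iff (hW : IsWienerProcess P ℱ W) (hIo : IsOpen I) (hIc : I.OrdConnected)
    (ha : ContinuousOn a I) (hb : ContDiffOn ℝ 1 b I) (hb0 : ∀ z ∈ I, b z ≠ 0) (hbᵤ : bᵤ ≠ 0)
    (hu : ContDiffOn ℝ 2 u I) :
    MapsToBrownian P ℱ W I a b u aᵤ bᵤ ↔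
      ∀ z ∈ I, deriv u z = bᵤ / b z ∧ a z = aᵤ / bᵤ * b z + 1 / 2 * b z * deriv b z := by
  have := hW.isProbabilityMeasure
  constructor
  · rintro ⟨hex, hall⟩
    have key : ∀ z ∈ I, aᵤ = a z * deriv u z + 1 / 2 * b z ^ 2 * deriv (deriv u) z ∧
        bᵤ = b z * deriv u z := by
      intro z hz
      obtain ⟨x, τ, hx, hx0⟩ := hex z hz
      have h1 := (isBrownianWithDrift_iff_ae hW hIo ha hb.continuousOn hu hx).1 (hall x τ hx)
      -- An almost sure event of a probability measure is nonempty; one of its points yields the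
      -- equations at z.
      obtain ⟨ω, hω, hτ, hxz⟩ := (h1.and hx0).exists
      have := hω 0 hτ
      rwa [hxz] at this
    have hu' : ∀ z ∈ I, deriv u z = bᵤ / b z := fun z hz => by
      rw [eq_div_iff (hb0 z hz), (key z hz).2, mul_comm]
    refine fun z hz => ⟨hu' z hz, ?_⟩
    rw [← drift_eq_iff hbᵤ (hb0 z hz), ← deriv_deriv_of_deriv_eq_div hIo hb hb0 hu' hz, ← hu' z hz]
    exact (key z hz).1
  · intro h
    have hu' : ∀ z ∈ I, deriv u z = bᵤ / b z := fun z hz => (h z hz).1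
    refine ⟨fun y hy => exists_isItoSolution hW hIo hIc hb hb0 hbᵤ (fun z hz => (h z hz).2)
      (fun z hz => hasDerivAt_of_deriv_eq_div hIo hu hu' hz) hy, fun x τ hx => ?_⟩
    refine (isBrownianWithDrift_iff_ae hW hIo ha hb.continuousOn hu hx).2
      (ae_of_all _ fun ω t ht => ?_)
    have hz := hx.mem ω t ht
    rw [deriv_deriv_of_deriv_eq_div hIo hb hb0 hu' hz, hu' _ hz]
    exact ⟨(drift_eq_iff hbᵤ (hb0 _ hz)).2 (h _ hz).2, (mul_div_cancel₀ _ (hb0 _ hz)).symm⟩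

theorem mapsToBrownian_integral (hW : IsWienerProcess P ℱ W) (hIo : IsOpen I)
    (hIc : I.OrdConnected) (ha : ContinuousOn a I) (hb : ContDiffOn ℝ 1 b I)
    (hb0 : ∀ z ∈ I, b z ≠ 0) (hbᵤ : bᵤ ≠ 0)
    (hcons : ∀ z ∈ I, a z = aᵤ / bᵤ * b z + 1 / 2 * b z * deriv b z) {x₀ : ℝ} (hx₀ : x₀ ∈ I) :
    MapsToBrownian P ℱ W I a b (fun z => ∫ y in x₀..z, bᵤ / b y) aᵤ bᵤ :=
  (mapsToBrownian_iff hW hIo hIc ha hb hb0 hbᵤ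
    (contDiffOn_integral_div hIo hIc hb hb0 bᵤ hx₀)).2 fun z hz =>
    ⟨(hasDerivAt_integral_div hIo hIc hb hb0 bᵤ hx₀ hz).deriv, hcons z hz⟩

end Main

theorem mainTheorem2 {Ω : Type*} {mΩ : MeasurableSpace Ω} (P : Measure Ω)
    (ℱ : Filtration ℝ≥0 mΩ) (W : ℝ≥0 → Ω → ℝ) (hW : IsWienerProcess P ℱ W)
    (I : Set ℝ) (hIo : IsOpen I) (hIc : I.OrdConnected)
    (a b : ℝ → ℝ) (ha : ContinuousOn a I) (hb : ContDiffOn ℝ 1 b I) (hb0 : ∀ x ∈ I, b x ≠ 0) :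
    -- along a single wealth process: the two equations for the coefficients
    (∀ (aᵤ bᵤ : ℝ) (u : ℝ → ℝ), ContDiffOn ℝ 2 u I →
      ∀ (x : ℝ≥0 → Ω → ℝ) (τ : Ω → WithTop ℝ≥0), IsItoSolution P ℱ W I a b x τ →
        (IsBrownianWithDrift P ℱ W aᵤ bᵤ (fun t ω => u (x t ω)) τ ↔
          ∀ᵐ ω ∂P, ∀ t : ℝ≥0, (t : WithTop ℝ≥0) < τ ω →
            aᵤ = a (x t ω) * deriv u (x t ω) + 1 / 2 * b (x t ω) ^ 2 * deriv (deriv u) (x t ω) ∧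
            bᵤ = b (x t ω) * deriv u (x t ω))) ∧
    -- for the dynamic on the whole of `I`, with given constants
    (∀ aᵤ bᵤ : ℝ, bᵤ ≠ 0 →
      (∀ u : ℝ → ℝ, ContDiffOn ℝ 2 u I →
        (MapsToBrownian P ℱ W I a b u aᵤ bᵤ ↔
          ∀ x ∈ I, deriv u x = bᵤ / b x ∧
            a x = aᵤ / bᵤ * b x + 1 / 2 * b x * deriv b x)) ∧
      ((∃ u : ℝ → ℝ, ContDiffOn ℝ 2 u I ∧ (StrictMonoOn u I ∨ StrictAntiOn u I) ∧
          MapsToBrownian P ℱ W I a b u aᵤ bᵤ) ↔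
        ∀ x ∈ I, a x = aᵤ / bᵤ * b x + 1 / 2 * b x * deriv b x) ∧
      ((∀ x ∈ I, a x = aᵤ / bᵤ * b x + 1 / 2 * b x * deriv b x) →
        ∀ x₀ ∈ I, ∀ u : ℝ → ℝ,
          (ContDiffOn ℝ 2 u I ∧ MapsToBrownian P ℱ W I a b u aᵤ bᵤ) ↔
            ∃ C : ℝ, ∀ x ∈ I, u x = (∫ y in x₀..x, bᵤ / b y) + C)) ∧
    -- existence of an increasing utility is decided by the dynamic alone
    ((∃ (aᵤ bᵤ : ℝ) (u : ℝ → ℝ), bᵤ ≠ 0 ∧ ContDiffOn ℝ 2 u I ∧ StrictMonoOn u I ∧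
        MapsToBrownian P ℱ W I a b u aᵤ bᵤ) ↔
      ∃ k : ℝ, ∀ x ∈ I, a x = k * b x + 1 / 2 * b x * deriv b x) := by
  refine ⟨fun aᵤ bᵤ u hu x τ hx => isBrownianWithDrift_iff_ae hW hIo ha hb.continuousOn hu hx,
    fun aᵤ bᵤ hbᵤ => ⟨fun u hu => mapsToBrownian_iff hW hIo hIc ha hb hb0 hbᵤ hu, ?_, ?_⟩, ?_⟩
  · constructor
    · rintro ⟨u, hu, -, hmaps⟩ z hz
      exact ((mapsToBrownian_iff hW hIo hIc ha hb hb0 hbᵤ hu).1 hmaps z hz).2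
    · intro hcons
      -- An empty I has no base point for the integral, but then every condition is vacuous.
      rcases I.eq_empty_or_nonempty with rfl | ⟨x₀, hx₀⟩
      · have h0 : ContDiffOn ℝ 2 (fun _ : ℝ => (0 : ℝ)) ∅ := contDiffOn_const
        exact ⟨fun _ => 0, h0, Or.inl fun z hz => hz.elim,
          (mapsToBrownian_iff hW hIo hIc ha hb hb0 hbᵤ h0).2 fun z hz => hz.elim⟩
      · exact ⟨_, contDiffOn_integral_div hIo hIc hb hb0 bᵤ hx₀,
          strictMonoOn_or_strictAntiOn hIo hIc
            (fun z hz => hasDerivAt_integral_div hIo hIc hb hb0 bᵤ hx₀ hz)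
            (contDiffOn_const_div hb hb0 bᵤ).continuousOn
            fun z hz => div_ne_zero hbᵤ (hb0 z hz),
          mapsToBrownian_integral hW hIo hIc ha hb hb0 hbᵤ hcons hx₀⟩
  · intro hcons x₀ hx₀ u
    have hint := fun z hz => hasDerivAt_integral_div hIo hIc hb hb0 bᵤ hx₀ (z := z) hz
    constructor
    · rintro ⟨hu, hmaps⟩
      have hu' := fun z hz => ((mapsToBrownian_iff hW hIo hIc ha hb hb0 hbᵤ hu).1 hmaps z hz).1
      refine ⟨u x₀, fun z hz => ?_⟩
      -- Zero derivative on the convex set I: the difference keeps its value at x₀, so the constant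
      -- is u x₀.
      have := hIc.convex.norm_image_sub_le_of_norm_hasDerivWithin_le
        (f := fun z => u z - ∫ y in x₀..z, bᵤ / b y) (f' := fun _ => 0) (C := 0)
        (fun w hw => ((hasDerivAt_of_deriv_eq_div hIo hu hu' hw).sub
          (hint w hw)).congr_deriv (sub_self _) |>.hasDerivWithinAt) (by simp) hx₀ hz
      rw [zero_mul, norm_le_zero_iff, intervalIntegral.integral_same, sub_zero] at this
      linarith
    · rintro ⟨C, hC⟩
      have hd : ∀ z ∈ I, HasDerivAt u (bᵤ / b z) z := fun z hz =>
        ((hint z hz).add_const C).congr_of_eventuallyEq (by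
          filter_upwards [hIo.mem_nhds hz] with w hw using hC w hw)
      have hu := contDiffOn_two_of_hasDerivAt hIo hd (contDiffOn_const_div hb hb0 bᵤ)
      exact ⟨hu, (mapsToBrownian_iff hW hIo hIc ha hb hb0 hbᵤ hu).2 fun z hz =>
        ⟨(hd z hz).deriv, hcons z hz⟩⟩
  · constructor
    · rintro ⟨aᵤ, bᵤ, u, hbᵤ, hu, -, hmaps⟩
      exact ⟨aᵤ / bᵤ, fun z hz => ((mapsToBrownian_iff hW hIo hIc ha hb hb0 hbᵤ hu).1 hmaps z hz).2⟩
    · rintro ⟨k, hk⟩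
      rcases I.eq_empty_or_nonempty with rfl | ⟨x₀, hx₀⟩
      · have h0 : ContDiffOn ℝ 2 (fun _ : ℝ => (0 : ℝ)) ∅ := contDiffOn_const
        exact ⟨0, 1, fun _ => 0, one_ne_zero, h0, fun z hz => hz.elim,
          (mapsToBrownian_iff hW hIo hIc ha hb hb0 one_ne_zero h0).2 fun z hz => hz.elim⟩
      -- The volatility c takes the constant sign of b, so that the utility increases; the drift k *
      -- c then keeps the ratio aᵤ/bᵤ equal to k.
      · obtain ⟨c, hc, hpos⟩ : ∃ c : ℝ, c ≠ 0 ∧ ∀ z ∈ I, 0 < c / b z := by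
          rcases hIc.forall_pos_or_forall_neg hb.continuousOn hb0 with h | h
          · exact ⟨1, one_ne_zero, fun z hz => div_pos one_pos (h z hz)⟩
          · exact ⟨-1, by norm_num, fun z hz => div_pos_of_neg_of_neg (by norm_num) (h z hz)⟩
        refine ⟨k * c, c, _, hc, contDiffOn_integral_div hIo hIc hb hb0 c hx₀,
          strictMonoOn_of_hasDerivAt_pos hIo hIc
            (fun z hz => hasDerivAt_integral_div hIo hIc hb hb0 c hx₀ hz) hpos,
          mapsToBrownian_integral hW hIo hIc ha hb hb0 hc (fun z hz => ?_) hx₀⟩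
        rw [mul_div_cancel_right₀ _ hc]
        exact hk z hz
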